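/- Let $G$ be a finite group, $H \le G$ a subgroup and $N \trianglelefteq G$ a normal subgroup. For a finite group $K$, let $\mathcal A_{\mathbb N}^K$ be the Burnside category, whose objects are finite $K$-sets and whose morphisms are isomorphism classes of spans $S \leftarrow U \to T$, composed by pullback. A $K$-Mackey functor is a product preserving functor $M\colon \mathcal A_{\mathbb N}^K \to \mathrm{Set}$ such that each commutative monoid $M(T)$ is a group; morphisms are natural transformations. The norm $N_H^G M$ of an $H$-Mackey functor $M$ is the left Kan extension of $M$ along the coinduction functor $F_H(G,-)\colon \mathcal A_{\mathbb N}^H \to \mathcal A_{\mathbb N}^G$, and the box product $M \,\Box\, M'$ of $K$-Mackey functors is the left Kan extension of $(S,T) \mapsto M(S)\times M'(T)$ along $(S,T) \mapsto S\times T$. Let $A$ be the Burnside Mackey functor of $K$, so that $A(T)$ is the group completion of $\mathcal A_{\mathbb N}^K(*,T)$. For a normal subgroup $L \trianglelefteq K$, let $E\mathcal F_L(A) \subseteq A$ be the sub-Mackey functor generated by the groups $A(K/J)$ for all subgroups $J \le K$ not containing $L$, and put $\tilde E\mathcal F_L(M) = M \,\Box\, (A/E\mathcal F_L(A))$. The pullback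 $\pi_L^*$ from $K/L$-Mackey functors to $K$-Mackey functors is $(\pi_L^*X)(T) = X(T^L)$, and the geometric fixed points of $M$ are $\Phi^L M = (\pi_L^*)^{-1}\big(\tilde E\mathcal F_L(M)\big)$, a $K/L$-Mackey functor; explicitly, $\Phi^L M$ is the restriction of $\tilde E\mathcal F_L(M)$ along the inflation functor from finite $K/L$-sets to finite $K$-sets. Then for every $H$-Mackey functor $M$ there is an isomorphism of $G/N$-Mackey functors, natural in $M$, \[ \Phi^N N_H^G M \;\cong\; N_{HN/N}^{G/N}\, \Phi^{H\cap N} M , \] where the $H/(H\cap N)$-Mackey functor $\Phi^{H\cap N}M$ is regarded as an $HN/N$-Mackey functor through the isomorphism $H/(H\cap N) \cong HN/N$. In particular, both sides are $G/N$-Mackey functors. -/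

import Mathlib

open CategoryTheory Limits

universe w v u

namespace MackeyNorm

section Burnside

/-- Spans `X ← U → Y` in a category. -/
abbrev Spn {C : Type u} [Category.{v} C] (X Y : C) :=
  Span (⊤ : MorphismProperty C) (⊤ : MorphismProperty C) X Y

/-- The span `X ← U → Y` with the given legs. -/
abbrev Spn.mk {C : Type u} [Category.{v} C] {X Y U : C} (l : U ⟶ X) (r : U ⟶ Y) : Spn X Y :=
  { apex := U, l := l, r := r, wl := trivial, wr := trivial }

/-- Isomorphism classes of spans. -/
def SpnClass {C : Type u} [Category.{v} C] (X Y : C) : Type (max u v) :=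
  Quotient (isIsomorphicSetoid (Spn X Y))

/-- The class `[X ← U → Y]`. -/
def SpnClass.mk {C : Type u} [Category.{v} C] {X Y U : C} (l : U ⟶ X) (r : U ⟶ Y) :
    SpnClass X Y :=
  Quotient.mk (isIsomorphicSetoid (Spn X Y)) (Spn.mk l r)

namespace SpnClass

variable {C : Type u} [Category.{v} C]

theorem ind {X Y : C} {P : SpnClass X Y → Prop}
    (h : ∀ (U : C) (l : U ⟶ X) (r : U ⟶ Y), P (SpnClass.mk l r)) (a : SpnClass X Y) : P a := by
  induction a using Quotient.inductionOn with
  | h s => exact h s.apex s.l s.r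

theorem mk_eq {X Y U V : C} {l : U ⟶ X} {r : U ⟶ Y} {l' : V ⟶ X} {r' : V ⟶ Y}
    (e : U ≅ V) (hl : e.hom ≫ l' = l) (hr : e.hom ≫ r' = r) :
    SpnClass.mk l r = SpnClass.mk l' r' :=
  Quotient.sound ⟨Span.mkIso e hl hr⟩

theorem mk_eq_iff {X Y U V : C} {l : U ⟶ X} {r : U ⟶ Y} {l' : V ⟶ X} {r' : V ⟶ Y} :
    SpnClass.mk l r = SpnClass.mk l' r' ↔
      ∃ e : U ≅ V, e.hom ≫ l' = l ∧ e.hom ≫ r' = r := by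
  refine ⟨fun h => ?_, fun ⟨e, hl, hr⟩ => mk_eq e hl hr⟩
  obtain ⟨i⟩ := Quotient.exact h
  exact ⟨⟨i.hom.hom, i.inv.hom, congrArg Span.Hom.hom i.hom_inv_id,
    congrArg Span.Hom.hom i.inv_hom_id⟩, i.hom.hom_l, i.hom.hom_r⟩

/-- Define a function on isomorphism classes of spans from one on spans. -/
def lift {X Y : C} {β : Sort*} (f : ∀ (U : C), (U ⟶ X) → (U ⟶ Y) → β)
    (hf : ∀ (U V : C) (e : U ≅ V) (l : V ⟶ X) (r : V ⟶ Y),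
      f U (e.hom ≫ l) (e.hom ≫ r) = f V l r) (a : SpnClass X Y) : β :=
  Quotient.lift (fun s : Spn X Y => f s.apex s.l s.r) (by
    rintro s t ⟨i⟩
    have h := hf s.apex t.apex ⟨i.hom.hom, i.inv.hom, congrArg Span.Hom.hom i.hom_inv_id,
      congrArg Span.Hom.hom i.inv_hom_id⟩ t.l t.r
    simpa using h) a

@[simp]
theorem lift_mk {X Y U : C} {β : Sort*} (f : ∀ (U : C), (U ⟶ X) → (U ⟶ Y) → β)
    (hf : ∀ (U V : C) (e : U ≅ V) (l : V ⟶ X) (r : V ⟶ Y),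
      f U (e.hom ≫ l) (e.hom ≫ r) = f V l r) (l : U ⟶ X) (r : U ⟶ Y) :
    lift f hf (SpnClass.mk l r) = f U l r := rfl

/-- Composition of isomorphism classes of spans, by pullback. -/
noncomputable def comp [HasPullbacks C] {X Y Z : C} (a : SpnClass X Y) (b : SpnClass Y Z) :
    SpnClass X Z :=
  lift (fun _ l r => lift (fun _ l' r' =>
      SpnClass.mk (pullback.fst r l' ≫ l) (pullback.snd r l' ≫ r'))
    (by
      intro V V' e l' r'
      refine mk_eq (asIso (pullback.map r (e.hom ≫ l') r l' (𝟙 _) e.hom (𝟙 _)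
        (by simp) (by simp))) ?_ ?_ <;>
        simp [pullback.map, pullback.lift_fst_assoc, pullback.lift_snd_assoc]) b)
    (by
      intro U U' e l r
      induction b using ind with
      | h V l' r' =>
        refine mk_eq (asIso (pullback.map (e.hom ≫ r) l' r l' e.hom (𝟙 _) (𝟙 _)
          (by simp) (by simp))) ?_ ?_ <;>
        simp [pullback.map, pullback.lift_fst_assoc, pullback.lift_snd_assoc]) a

/-- Composites of spans may be computed with any pullback square. -/
theorem comp_mk [HasPullbacks C] {X Y Z U V P : C} {l : U ⟶ X} {r : U ⟶ Y} {l' : V ⟶ Y}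
    {r' : V ⟶ Z} {p : P ⟶ U} {q : P ⟶ V} (h : IsPullback p q r l') :
    comp (SpnClass.mk l r) (SpnClass.mk l' r') = SpnClass.mk (p ≫ l) (q ≫ r') := by
  refine mk_eq h.isoPullback.symm ?_ ?_ <;> simp

end SpnClass

/-- The Burnside category of `C`: its objects are those of `C`, its morphisms are the
isomorphism classes of spans, and composition is by pullback. -/
structure Burnside (C : Type u) where
  /-- The underlying object. -/
  as : C

namespace Burnside

variable {C : Type u} [Category.{v} C] [HasPullbacks C]

noncomputable instance : Category.{max u v} (Burnside C) where
  Hom X Y := SpnClass X.as Y.as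
  id X := SpnClass.mk (𝟙 X.as) (𝟙 X.as)
  comp a b := SpnClass.comp a b
  id_comp {X Y} a := by
    induction a using SpnClass.ind with
    | h U l r =>
      rw [SpnClass.comp_mk (p := l) (q := 𝟙 U) (IsPullback.of_vert_isIso ⟨by simp⟩)]
      simp
  comp_id {X Y} a := by
    induction a using SpnClass.ind with
    | h U l r =>
      rw [SpnClass.comp_mk (p := 𝟙 U) (q := r) (IsPullback.of_horiz_isIso ⟨by simp⟩)]
      simp
  assoc {W X Y Z} a b c := by
    induction a using SpnClass.ind with
    | h U₁ l₁ r₁ =>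
    induction b using SpnClass.ind with
    | h U₂ l₂ r₂ =>
    induction c using SpnClass.ind with
    | h U₃ l₃ r₃ =>
      have h₁₂ := IsPullback.of_hasPullback r₁ l₂
      have h₂₃ := IsPullback.of_hasPullback r₂ l₃
      have h := IsPullback.of_hasPullback (pullback.snd r₁ l₂) (pullback.fst r₂ l₃)
      rw [SpnClass.comp_mk h₁₂, SpnClass.comp_mk h₂₃, SpnClass.comp_mk (h.paste_vert h₂₃),
        SpnClass.comp_mk (h.paste_horiz h₁₂)]
      simp

/-- The class of `X ← U → Y` as a morphism of the Burnside category. -/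
def span {X Y U : C} (l : U ⟶ X) (r : U ⟶ Y) : (Burnside.mk X ⟶ Burnside.mk Y) :=
  SpnClass.mk l r

theorem hom_ind {X Y : C} {P : (Burnside.mk X ⟶ Burnside.mk Y) → Prop}
    (h : ∀ (U : C) (l : U ⟶ X) (r : U ⟶ Y), P (span l r)) (a : Burnside.mk X ⟶ Burnside.mk Y) :
    P a :=
  SpnClass.ind h a

theorem id_eq_span (X : C) : 𝟙 (Burnside.mk X) = span (𝟙 X) (𝟙 X) := rfl

theorem span_eq {X Y U V : C} {l : U ⟶ X} {r : U ⟶ Y} {l' : V ⟶ X} {r' : V ⟶ Y}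
    (e : U ≅ V) (hl : e.hom ≫ l' = l) (hr : e.hom ≫ r' = r) : span l r = span l' r' :=
  SpnClass.mk_eq e hl hr

theorem span_comp {X Y Z U V P : C} {l : U ⟶ X} {r : U ⟶ Y} {l' : V ⟶ Y}
    {r' : V ⟶ Z} {p : P ⟶ U} {q : P ⟶ V} (h : IsPullback p q r l') :
    span l r ≫ span l' r' = span (p ≫ l) (q ≫ r') :=
  SpnClass.comp_mk h

/-- The restriction along `f : X ⟶ Y`: the class of `Y ← X = X`. -/
def res {X Y : C} (f : X ⟶ Y) : (Burnside.mk Y ⟶ Burnside.mk X) := span f (𝟙 X)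

/-- The transfer along `f : X ⟶ Y`: the class of `X = X → Y`. -/
def tr {X Y : C} (f : X ⟶ Y) : (Burnside.mk X ⟶ Burnside.mk Y) := span (𝟙 X) f

/-- The functor on Burnside categories induced by a functor that preserves pullbacks. -/
noncomputable def map {D : Type*} [Category D] [HasPullbacks D] (F : C ⥤ D)
    [PreservesLimitsOfShape WalkingCospan F] : Burnside C ⥤ Burnside D where
  obj X := ⟨F.obj X.as⟩
  map {X Y} a := SpnClass.lift (fun _ l r => span (F.map l) (F.map r))
    (fun U V e l r => span_eq (F.mapIso e) (by simp) (by simp)) a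
  map_id X := by
    change span (F.map (𝟙 _)) (F.map (𝟙 _)) = _
    rw [F.map_id]; rfl
  map_comp {X Y Z} a b := by
    obtain ⟨X⟩ := X
    obtain ⟨Y⟩ := Y
    obtain ⟨Z⟩ := Z
    induction a using hom_ind with
    | h U l r =>
    induction b using hom_ind with
    | h V l' r' =>
      have h := IsPullback.of_hasPullback r l'
      rw [span_comp h]
      change span _ _ = span _ _ ≫ span _ _
      rw [span_comp (h.map F)]
      simp

theorem map_span {D : Type*} [Category D] [HasPullbacks D] (F : C ⥤ D)
    [PreservesLimitsOfShape WalkingCospan F] {X Y U : C} (l : U ⟶ X) (r : U ⟶ Y) :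
    (map F).map (span l r) = span (F.map l) (F.map r) := rfl

/-- Isomorphic functors induce isomorphic functors on Burnside categories. -/
noncomputable def mapNatIso {D : Type*} [Category D] [HasPullbacks D] {F F' : C ⥤ D}
    [PreservesLimitsOfShape WalkingCospan F] [PreservesLimitsOfShape WalkingCospan F']
    (e : F ≅ F') : map F ≅ map F' :=
  NatIso.ofComponents
    (fun X =>
      { hom := tr (e.hom.app X.as)
        inv := tr (e.inv.app X.as)
        hom_inv_id := by
          refine (span_comp (p := 𝟙 _) (q := e.hom.app X.as)
            (IsPullback.of_vert_isIso ⟨by simp⟩)).trans ?_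
          simp only [Category.comp_id, Iso.hom_inv_id_app]
          rfl
        inv_hom_id := by
          refine (span_comp (p := 𝟙 _) (q := e.inv.app X.as)
            (IsPullback.of_vert_isIso ⟨by simp⟩)).trans ?_
          simp only [Category.comp_id, Iso.inv_hom_id_app]
          rfl })
    (by
      rintro ⟨X⟩ ⟨Y⟩ a
      induction a using hom_ind with
      | h U l r =>
        refine (span_comp (p := 𝟙 _) (q := F.map r)
          (IsPullback.of_horiz_isIso ⟨by simp⟩)).trans ?_
        refine Eq.trans ?_ (span_comp (p := F.map l) (q := e.hom.app U)
          (IsPullback.of_vert_isIso ⟨by simp⟩)).symm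
        simp)

/-- `map` is compatible with identities. -/
noncomputable def mapIdIso : map (𝟭 C) ≅ 𝟭 (Burnside C) :=
  NatIso.ofComponents (fun X => Iso.refl X) (by
    rintro ⟨X⟩ ⟨Y⟩ a
    induction a using hom_ind with
    | h U l r => exact (Category.comp_id _).trans (Category.id_comp _).symm)

/-- `map` is compatible with composition. -/
noncomputable def mapCompIso {D : Type*} [Category D] [HasPullbacks D] {E : Type*} [Category E]
    [HasPullbacks E] (F : C ⥤ D) (F' : D ⥤ E) [PreservesLimitsOfShape WalkingCospan F]
    [PreservesLimitsOfShape WalkingCospan F'] : map F ⋙ map F' ≅ map (F ⋙ F') :=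
  NatIso.ofComponents (fun X => Iso.refl _) (by
    rintro ⟨X⟩ ⟨Y⟩ a
    induction a using hom_ind with
    | h U l r => exact (Category.comp_id _).trans (Category.id_comp _).symm)

theorem isPullback_prodMap {C : Type u} [Category.{v} C] [HasBinaryProducts C]
    {P U V Y P' U' V' Y' : C} {p : P ⟶ U} {q : P ⟶ V}
    {r : U ⟶ Y} {l : V ⟶ Y} {p' : P' ⟶ U'} {q' : P' ⟶ V'} {r' : U' ⟶ Y'} {l' : V' ⟶ Y'}
    (h : IsPullback p q r l) (h' : IsPullback p' q' r' l') :
    IsPullback (prod.map p p') (prod.map q q') (prod.map r r') (prod.map l l') := by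
  refine ⟨⟨by rw [prod.map_map, prod.map_map, h.w, h'.w]⟩, ⟨PullbackCone.IsLimit.mk _
    (fun s => prod.lift
      (h.lift (s.fst ≫ prod.fst) (s.snd ≫ prod.fst)
        (by simpa using s.condition =≫ prod.fst))
      (h'.lift (s.fst ≫ prod.snd) (s.snd ≫ prod.snd)
        (by simpa using s.condition =≫ prod.snd)))
    (fun s => by ext <;> simp [prod.lift_fst, prod.lift_snd])
    (fun s => by ext <;> simp [prod.lift_fst, prod.lift_snd]) (fun s m hm₁ hm₂ => ?_)⟩⟩
  ext
  · apply h.hom_ext <;> simp [← hm₁, ← hm₂, prod.lift_fst_assoc]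
  · apply h'.hom_ext <;> simp [← hm₁, ← hm₂, prod.lift_snd_assoc]

/-- The functor on Burnside categories induced by the Cartesian product. -/
noncomputable def prod [HasBinaryProducts C] : Burnside C × Burnside C ⥤ Burnside C where
  obj X := ⟨X.1.as ⨯ X.2.as⟩
  map {X Y} a := SpnClass.lift (fun _ l₁ r₁ => SpnClass.lift (fun _ l₂ r₂ =>
      span (prod.map l₁ l₂) (prod.map r₁ r₂))
    (fun U V e l r => span_eq (prod.mapIso (Iso.refl _) e) (by simp) (by simp)) a.2)
    (fun U V e l r => by
      obtain ⟨a₁, a₂⟩ := a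
      induction a₂ using SpnClass.ind with
      | h W l' r' => exact span_eq (prod.mapIso e (Iso.refl _)) (by simp) (by simp)) a.1
  map_id X := by
    change span (prod.map (𝟙 _) (𝟙 _)) (prod.map (𝟙 _) (𝟙 _)) = _
    rw [prod.map_id_id]; rfl
  map_comp {X Y Z} a b := by
    obtain ⟨⟨X₁⟩, ⟨X₂⟩⟩ := X
    obtain ⟨⟨Y₁⟩, ⟨Y₂⟩⟩ := Y
    obtain ⟨⟨Z₁⟩, ⟨Z₂⟩⟩ := Z
    obtain ⟨a₁, a₂⟩ := a
    obtain ⟨b₁, b₂⟩ := b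
    dsimp only at a₁ a₂ b₁ b₂
    induction a₁ using hom_ind with
    | h U₁ l₁ r₁ =>
    induction a₂ using hom_ind with
    | h U₂ l₂ r₂ =>
    induction b₁ using hom_ind with
    | h V₁ l₁' r₁' =>
    induction b₂ using hom_ind with
    | h V₂ l₂' r₂' =>
      have h₁ := IsPullback.of_hasPullback r₁ l₁'
      have h₂ := IsPullback.of_hasPullback r₂ l₂'
      rw [CategoryTheory.prod_comp, span_comp h₁, span_comp h₂]
      change span _ _ = span _ _ ≫ span _ _
      rw [span_comp (isPullback_prodMap h₁ h₂), prod.map_map, prod.map_map]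

theorem prod_map_span [HasBinaryProducts C] {X Y U X' Y' U' : C} (l : U ⟶ X) (r : U ⟶ Y)
    (l' : U' ⟶ X') (r' : U' ⟶ Y') :
    (prod (C := C)).map (X := (⟨X⟩, ⟨X'⟩)) (Y := (⟨Y⟩, ⟨Y'⟩)) (span l r, span l' r') =
      span (prod.map l l') (prod.map r r') := rfl

section Additive

variable [FinitaryExtensive C]

theorem isPullback_coprodDesc {P P' U U' V Y : C} {p : P ⟶ U} {q : P ⟶ V}
    {p' : P' ⟶ U'} {q' : P' ⟶ V} {r : U ⟶ Y} {r' : U' ⟶ Y} {l : V ⟶ Y}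
    (h : IsPullback p q r l) (h' : IsPullback p' q' r' l) :
    IsPullback (coprod.map p p') (coprod.desc q q') (coprod.desc r r') l := by
  have hP := IsPullback.of_hasPullback (coprod.desc r r') l
  let i : P ⟶ pullback (coprod.desc r r') l :=
    hP.lift (p ≫ coprod.inl) q (by rw [Category.assoc, coprod.inl_desc, h.w])
  let i' : P' ⟶ pullback (coprod.desc r r') l :=
    hP.lift (p' ≫ coprod.inr) q' (by rw [Category.assoc, coprod.inr_desc, h'.w])
  have s : IsPullback p i coprod.inl (pullback.fst (coprod.desc r r') l) :=
    IsPullback.of_bot (by rwa [hP.lift_snd, coprod.inl_desc]) (hP.lift_fst _ _ _).symm hP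
  have s' : IsPullback p' i' coprod.inr (pullback.fst (coprod.desc r r') l) :=
    IsPullback.of_bot (by rwa [hP.lift_snd, coprod.inr_desc]) (hP.lift_fst _ _ _).symm hP
  obtain ⟨hc⟩ := ((BinaryCofan.isVanKampen_iff _).1
    (FinitaryExtensive.vanKampen _ (coprodIsCoprod U U')) (BinaryCofan.mk i i') p p'
    (pullback.fst (coprod.desc r r') l) s.w s'.w).2 ⟨s.flip, s'.flip⟩
  let e : P ⨿ P' ≅ pullback (coprod.desc r r') l :=
    (coprodIsCoprod P P').coconePointUniqueUpToIso hc
  have e₁ : coprod.inl ≫ e.hom = i :=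
    (coprodIsCoprod P P').comp_coconePointUniqueUpToIso_hom hc ⟨WalkingPair.left⟩
  have e₂ : coprod.inr ≫ e.hom = i' :=
    (coprodIsCoprod P P').comp_coconePointUniqueUpToIso_hom hc ⟨WalkingPair.right⟩
  refine hP.of_iso e.symm (Iso.refl _) (Iso.refl _) (Iso.refl _) ?_ ?_ (by simp) (by simp)
  · rw [Iso.refl_hom, Category.comp_id, Iso.symm_hom, Iso.eq_inv_comp]
    apply coprod.hom_ext
    · rw [reassoc_of% e₁, hP.lift_fst, coprod.inl_map]
    · rw [reassoc_of% e₂, hP.lift_fst, coprod.inr_map]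
  · rw [Iso.refl_hom, Category.comp_id, Iso.symm_hom, Iso.eq_inv_comp]
    apply coprod.hom_ext
    · rw [reassoc_of% e₁, hP.lift_snd, coprod.inl_desc]
    · rw [reassoc_of% e₂, hP.lift_snd, coprod.inr_desc]

theorem isPullback_initial {V Y : C} (l : V ⟶ Y) :
    IsPullback (𝟙 (⊥_ C)) (initial.to V) (initial.to Y) l := by
  have hP := IsPullback.of_hasPullback (initial.to Y) l
  have : IsIso (pullback.fst (initial.to Y) l) := initialIsInitial.isIso_to _
  exact hP.of_iso (asIso (pullback.fst (initial.to Y) l)) (Iso.refl _) (Iso.refl _) (Iso.refl _)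
    (by simp) (by
      rw [← cancel_epi (inv (pullback.fst (initial.to Y) l))]
      exact initial.hom_ext _ _) (by simp) (by simp)

/-- The sum of spans: `[X ← U → Y] + [X ← V → Y] = [X ← U ⨿ V → Y]`. -/
noncomputable def addHom {X Y : C} (a b : SpnClass X Y) : SpnClass X Y :=
  SpnClass.lift (fun U l r => SpnClass.lift (fun V l' r' =>
      SpnClass.mk (U := U ⨿ V) (coprod.desc l l') (coprod.desc r r'))
    (fun U V e l' r' => SpnClass.mk_eq (coprod.mapIso (Iso.refl _) e)
      (by simp [coprod.map_desc]) (by simp [coprod.map_desc])) b)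
    (fun U V e l r => by
      induction b using SpnClass.ind with
      | h W l' r' =>
        simp only [SpnClass.lift_mk]
        exact SpnClass.mk_eq (coprod.mapIso e (Iso.refl _))
          (by simp [coprod.map_desc]) (by simp [coprod.map_desc])) a

noncomputable instance (X Y : Burnside C) : Add (X ⟶ Y) where
  add a b := addHom a b

/-- The zero morphism is the class of `X ← ∅ → Y`. -/
noncomputable instance (X Y : Burnside C) : Zero (X ⟶ Y) where
  zero := SpnClass.mk (initial.to X.as) (initial.to Y.as)

theorem span_add {X Y U V : C} (l : U ⟶ X) (r : U ⟶ Y) (l' : V ⟶ X) (r' : V ⟶ Y) :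
    span l r + span l' r' = span (coprod.desc l l') (coprod.desc r r') := rfl

theorem zero_eq_span (X Y : C) :
    (0 : Burnside.mk X ⟶ Burnside.mk Y) = span (initial.to X) (initial.to Y) := rfl

noncomputable instance (X Y : Burnside C) : AddCommMonoid (X ⟶ Y) where
  add_assoc a b c := by
    obtain ⟨X⟩ := X
    obtain ⟨Y⟩ := Y
    induction a using hom_ind with
    | h U₁ l₁ r₁ =>
    induction b using hom_ind with
    | h U₂ l₂ r₂ =>
    induction c using hom_ind with
    | h U₃ l₃ r₃ =>
      simp only [span_add]
      exact span_eq (coprod.associator U₁ U₂ U₃)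
        (by ext <;> simp [coprod.inl_desc, coprod.inr_desc, coprod.inl_desc_assoc,
          coprod.inr_desc_assoc])
        (by ext <;> simp [coprod.inl_desc, coprod.inr_desc, coprod.inl_desc_assoc,
          coprod.inr_desc_assoc])
  zero_add a := by
    obtain ⟨X⟩ := X
    obtain ⟨Y⟩ := Y
    induction a using hom_ind with
    | h U l r =>
      rw [zero_eq_span, span_add]
      exact span_eq (coprod.leftUnitor U) (by ext <;> simp [coprod.inl_desc, coprod.inr_desc])
        (by ext <;> simp [coprod.inl_desc, coprod.inr_desc])
  add_zero a := by
    obtain ⟨X⟩ := X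
    obtain ⟨Y⟩ := Y
    induction a using hom_ind with
    | h U l r =>
      rw [zero_eq_span, span_add]
      exact span_eq (coprod.rightUnitor U) (by ext <;> simp [coprod.inl_desc, coprod.inr_desc])
        (by ext <;> simp [coprod.inl_desc, coprod.inr_desc])
  add_comm a b := by
    obtain ⟨X⟩ := X
    obtain ⟨Y⟩ := Y
    induction a using hom_ind with
    | h U l r =>
    induction b using hom_ind with
    | h V l' r' =>
      rw [span_add, span_add]
      exact span_eq (coprod.braiding U V) (by ext <;> simp [coprod.inl_desc, coprod.inr_desc])
        (by ext <;> simp [coprod.inl_desc, coprod.inr_desc])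
  nsmul := nsmulRec

theorem add_comp {X Y Z : Burnside C} (a b : X ⟶ Y) (c : Y ⟶ Z) :
    (a + b) ≫ c = a ≫ c + b ≫ c := by
  obtain ⟨X⟩ := X
  obtain ⟨Y⟩ := Y
  obtain ⟨Z⟩ := Z
  induction a using hom_ind with
  | h U l r =>
  induction b using hom_ind with
  | h V l' r' =>
  induction c using hom_ind with
  | h W m n =>
    have h := IsPullback.of_hasPullback r m
    have h' := IsPullback.of_hasPullback r' m
    rw [span_add, span_comp h, span_comp h', span_add, span_comp (isPullback_coprodDesc h h'),
      coprod.map_desc, coprod.desc_comp]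

theorem zero_comp {X Y Z : Burnside C} (c : Y ⟶ Z) : (0 : X ⟶ Y) ≫ c = 0 := by
  obtain ⟨X⟩ := X
  obtain ⟨Y⟩ := Y
  obtain ⟨Z⟩ := Z
  induction c using hom_ind with
  | h W m n =>
    rw [zero_eq_span, span_comp (isPullback_initial m), zero_eq_span]
    congr 1 <;> exact initial.hom_ext _ _

end Additive

end Burnside
end Burnside

section GSets

/-- The category of finite `G`-sets. -/
abbrev FinGSet (G : Type u) [Group G] := Action FintypeCat.{u} G

/-- The action of `g` on an element of a finite `G`-set. -/
abbrev act {G : Type u} [Group G] (X : FinGSet G) (g : G) (x : X.V) : X.V :=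
  ConcreteCategory.hom (X.ρ g) x

instance : FinitaryExtensive FintypeCat.{u} :=
  finitaryExtensive_of_preserves_and_reflects_isomorphism FintypeCat.incl.{u}

instance (G : Type u) [Group G] : FinitaryExtensive (FinGSet G) :=
  finitaryExtensive_of_preserves_and_reflects_isomorphism (Action.forget FintypeCat.{u} G)

instance {G H : Type u} [Group G] [Group H] (f : G →* H) :
    PreservesLimitsOfShape WalkingCospan (Action.res FintypeCat.{u} f) := by
  apply Action.preservesLimitsOfShape_of_preserves
  exact inferInstanceAs (PreservesLimitsOfShape WalkingCospan (Action.forget FintypeCat.{u} H))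

/-- Coinduction: `F_H(G, T)` is the finite set of maps `f : G → T` with `f (h g) = h f(g)` for
`h ∈ H`, and `G` acts by `(g f)(g') = f(g' g)`. -/
def coind {G : Type u} [Group G] [Finite G] (H : Subgroup G) : FinGSet H ⥤ FinGSet G where
  obj T :=
    { V := FintypeCat.of {f : G → T.V // ∀ (h : H) (g : G), f (h * g) = act T h (f g)}
      ρ :=
        { toFun g := FintypeCat.homMk fun f =>
            ⟨fun g' => f.1 (g' * g), fun h g' =>
              (congrArg f.1 (mul_assoc (h : G) g' g)).trans (f.2 h (g' * g))⟩
          map_one' := by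
            refine FintypeCat.hom_ext _ _ fun f => Subtype.ext (funext fun g' => ?_)
            exact congrArg f.1 (mul_one g')
          map_mul' a b := by
            refine FintypeCat.hom_ext _ _ fun f => Subtype.ext (funext fun g' => ?_)
            exact congrArg f.1 (mul_assoc g' a b).symm } }
  map {S T} φ :=
    { hom := FintypeCat.homMk fun f => ⟨fun g => φ.hom (f.1 g), fun h g =>
        (congrArg φ.hom (f.2 h g)).trans (ConcreteCategory.congr_hom (φ.comm h) (f.1 g))⟩
      comm _ := rfl }

/-- Coinduction is right adjoint to restriction to the subgroup. -/
def resCoindAdjunction {G : Type u} [Group G] [Finite G] (H : Subgroup G) :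
    Action.res FintypeCat.{u} H.subtype ⊣ coind H :=
  Adjunction.mkOfHomEquiv
    { homEquiv X T :=
        { toFun φ :=
            { hom := FintypeCat.homMk fun x => ⟨fun g => φ.hom (act X g x), fun h g => by
                have e : act X (h * g) x = act X h (act X g x) :=
                  ConcreteCategory.congr_hom (map_mul X.ρ (h : G) g) x
                exact (congrArg φ.hom e).trans <|
                  ConcreteCategory.congr_hom (φ.comm h) (act X g x)⟩
              comm g := by
                ext x
                apply Subtype.ext
                funext g'
                change φ.hom (act X g' (act X g x)) = φ.hom (act X (g' * g) x)
                exact congrArg φ.hom (ConcreteCategory.congr_hom (map_mul X.ρ g' g) x).symm }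
          invFun ψ :=
            { hom := FintypeCat.homMk fun x => (ψ.hom x).1 1
              comm h := by
                ext x
                have e := congrArg (fun f => f.1 1) (ConcreteCategory.congr_hom (ψ.comm (h : G)) x)
                have e' := (ψ.hom x).2 h 1
                refine e.trans ?_
                refine Eq.trans ?_ e'
                exact congrArg (ψ.hom x).1 ((one_mul _).trans (mul_one _).symm) }
          left_inv φ := by
            ext x
            exact congrArg φ.hom (ConcreteCategory.congr_hom (map_one X.ρ) x)
          right_inv ψ := by
            ext x
            apply Subtype.ext
            funext g
            have e := congrArg (fun f => f.1 1) (ConcreteCategory.congr_hom (ψ.comm g) x)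
            exact e.trans (congrArg (ψ.hom x).1 (one_mul g)) }
      homEquiv_naturality_left_symm _ _ := rfl
      homEquiv_naturality_right _ _ := rfl }

instance {G : Type u} [Group G] [Finite G] (H : Subgroup G) :
    PreservesLimitsOfShape WalkingCospan (coind H) :=
  have := (resCoindAdjunction H).rightAdjoint_preservesLimits
  inferInstance

/-- Inflation of finite `G/N`-sets to finite `G`-sets. -/
abbrev infl {G : Type u} [Group G] (N : Subgroup G) [N.Normal] : FinGSet (G ⧸ N) ⥤ FinGSet G :=
  Action.res FintypeCat.{u} (QuotientGroup.mk' N)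

/-- The fixed points `T ↦ T^N`, with the induced action of `G/N`. -/
def fixedPts {G : Type u} [Group G] (N : Subgroup G) [N.Normal] :
    FinGSet G ⥤ FinGSet (G ⧸ N) where
  obj T :=
    { V := FintypeCat.of {t : T.V // ∀ n ∈ N, act T n t = t}
      ρ := QuotientGroup.lift N
        { toFun g := FintypeCat.homMk fun t => ⟨act T g t.1, fun n hn => by
            have e := t.2 (g⁻¹ * n * g) (by
              simpa using Subgroup.Normal.conj_mem ‹_› n hn g⁻¹)
            have e' : T.ρ n * T.ρ g = T.ρ g * T.ρ (g⁻¹ * n * g) := by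
              rw [← map_mul, ← map_mul]; congr 1; group
            exact (ConcreteCategory.congr_hom e' t.1).trans (congrArg (act T g) e)⟩
          map_one' := by
            refine FintypeCat.hom_ext _ _ fun t => Subtype.ext ?_
            exact ConcreteCategory.congr_hom (map_one T.ρ) t.1
          map_mul' a b := by
            refine FintypeCat.hom_ext _ _ fun t => Subtype.ext ?_
            exact ConcreteCategory.congr_hom (map_mul T.ρ a b) t.1 }
        (fun n hn => by
          refine FintypeCat.hom_ext _ _ fun t => Subtype.ext ?_
          exact t.2 n hn) }
  map {S T} φ :=
    { hom := FintypeCat.homMk fun t => ⟨φ.hom t.1, fun n hn =>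
        (ConcreteCategory.congr_hom (φ.comm n) t.1).symm.trans (congrArg φ.hom (t.2 n hn))⟩
      comm g := by
        induction g using QuotientGroup.induction_on with
        | H g =>
          refine FintypeCat.hom_ext _ _ fun t => Subtype.ext ?_
          exact (ConcreteCategory.congr_hom (φ.comm g) t.1) }

/-- The fixed points functor is right adjoint to inflation. -/
def inflFixedPtsAdjunction {G : Type u} [Group G] (N : Subgroup G) [N.Normal] :
    infl N ⊣ fixedPts N :=
  Adjunction.mkOfHomEquiv
    { homEquiv X T :=
        { toFun φ :=
            { hom := FintypeCat.homMk fun x => ⟨φ.hom x, fun n hn => by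
                have e := ConcreteCategory.congr_hom (φ.comm n) x
                have e' : act X (n : G ⧸ N) x = x := by
                  rw [(QuotientGroup.eq_one_iff n).2 hn]
                  exact ConcreteCategory.congr_hom (map_one X.ρ) x
                exact e.symm.trans (congrArg φ.hom e')⟩
              comm g := by
                induction g using QuotientGroup.induction_on with
                | H g =>
                  refine FintypeCat.hom_ext _ _ fun x => Subtype.ext ?_
                  exact ConcreteCategory.congr_hom (φ.comm g) x }
          invFun ψ :=
            { hom := FintypeCat.homMk fun x => (ψ.hom x).1
              comm g := by
                refine FintypeCat.hom_ext _ _ fun x => ?_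
                exact congrArg Subtype.val
                  (ConcreteCategory.congr_hom (ψ.comm (g : G ⧸ N)) x) }
          left_inv _ := rfl
          right_inv _ := rfl }
      homEquiv_naturality_left_symm _ _ := rfl
      homEquiv_naturality_right _ _ := rfl }

instance {G : Type u} [Group G] (N : Subgroup G) [N.Normal] :
    PreservesLimitsOfShape WalkingCospan (fixedPts N) :=
  have := (inflFixedPtsAdjunction N).rightAdjoint_preservesLimits
  inferInstance

/-- The `N`-fixed points of the inflation of `T` are `T`. -/
def inflFixedPtsIso {G : Type u} [Group G] (N : Subgroup G) [N.Normal] :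
    infl N ⋙ fixedPts N ≅ 𝟭 (FinGSet (G ⧸ N)) :=
  NatIso.ofComponents
    (fun T => Action.mkIso (FintypeCat.equivEquivIso
      { toFun t := t.1
        invFun t := ⟨t, fun n hn => by
          have e' : act T (n : G ⧸ N) t = t := by
            rw [(QuotientGroup.eq_one_iff n).2 hn]
            exact ConcreteCategory.congr_hom (map_one T.ρ) t
          exact e'⟩
        left_inv _ := rfl
        right_inv _ := rfl })
      (fun g => by
        induction g using QuotientGroup.induction_on with
        | H g => rfl))
    (fun _ => rfl)

end GSets

section Mackey

variable {G : Type u} [Group G]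

/-- The Burnside category of finite `G`-sets. -/
abbrev BurnsideCat (G : Type u) [Group G] := Burnside (FinGSet G)

/-- Functors from the Burnside category to sets. -/
abbrev SetFunctor (G : Type u) [Group G] := BurnsideCat G ⥤ Type (u + 1)

/-- A Mackey functor is a product preserving functor `M` from the Burnside category to sets such
that the commutative monoid `M(T)` is a group for all `T`. The sum of `x` and `y` in `M(T)` is
the image of `z` under the transfer along the fold map `T ⨿ T → T`, where `z ∈ M(T ⨿ T)` is the
element that restricts to `x` and to `y`; the zero element is the image of any element under the
zero endomorphism `[T ← ∅ → T]`. -/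
structure IsMackey (M : SetFunctor G) : Prop where
  preservesFiniteProducts : PreservesFiniteProducts M
  exists_neg : ∀ (T : FinGSet G) (x : M.obj ⟨T⟩), ∃ z : M.obj ⟨T ⨿ T⟩,
    M.map (Burnside.res coprod.inl) z = x ∧
    M.map (Burnside.tr (coprod.desc (𝟙 T) (𝟙 T))) z = M.map 0 x

/-- The category of `G`-Mackey functors. -/
abbrev Mack (G : Type u) [Group G] := ObjectProperty.FullSubcategory (IsMackey (G := G))

/-- The box product of set-valued functors on the Burnside category: the left Kan extension of
`(S, T) ↦ M(S) × N(T)` along `(S, T) ↦ S × T`. -/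
noncomputable def box (G : Type u) [Group G] : SetFunctor G × SetFunctor G ⥤ SetFunctor G :=
  MonoidalCategory.externalProductBifunctor (BurnsideCat G) (BurnsideCat G) (Type (u + 1)) ⋙
    (Burnside.prod (C := FinGSet G)).lan

/-- The group `𝒜(*, T)`: the group completion of the monoid of spans `* ← U → T`. -/
abbrev BurnsideGroup (T : BurnsideCat G) : Type (u + 1) :=
  Algebra.GrothendieckAddGroup ((⟨⊤_ (FinGSet G)⟩ : BurnsideCat G) ⟶ T)

/-- The effect on `𝒜(*, -)` of a morphism of the Burnside category. -/
noncomputable def BurnsideGroup.map {S T : BurnsideCat G} (f : S ⟶ T) :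
    BurnsideGroup S →+ BurnsideGroup T :=
  Algebra.GrothendieckAddGroup.lift
    (Algebra.GrothendieckAddGroup.of.comp
      { toFun := fun a => a ≫ f
        map_zero' := Burnside.zero_comp f
        map_add' := fun a b => Burnside.add_comp a b f })

theorem BurnsideGroup.map_of {S T : BurnsideCat G} (f : S ⟶ T)
    (a : (⟨⊤_ (FinGSet G)⟩ : BurnsideCat G) ⟶ S) :
    BurnsideGroup.map f (Algebra.GrothendieckAddGroup.of a) =
      Algebra.GrothendieckAddGroup.of (a ≫ f) :=
  DFunLike.congr_fun (Algebra.GrothendieckAddGroup.lift.symm_apply_apply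
    (Algebra.GrothendieckAddGroup.of.comp
      { toFun := fun a => a ≫ f
        map_zero' := Burnside.zero_comp f
        map_add' := fun a b => Burnside.add_comp a b f })) a

theorem BurnsideGroup.hom_ext {T : BurnsideCat G} {B : Type*} [AddCommGroup B]
    {φ ψ : BurnsideGroup T →+ B}
    (h : ∀ a, φ (Algebra.GrothendieckAddGroup.of a) = ψ (Algebra.GrothendieckAddGroup.of a)) :
    φ = ψ :=
  Algebra.GrothendieckAddGroup.lift.symm.injective (AddMonoidHom.ext h)

theorem BurnsideGroup.map_id (T : BurnsideCat G) :
    BurnsideGroup.map (𝟙 T) = AddMonoidHom.id _ := by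
  refine BurnsideGroup.hom_ext fun a => ?_
  rw [BurnsideGroup.map_of, Category.comp_id]
  rfl

theorem BurnsideGroup.map_comp {R S T : BurnsideCat G} (f : R ⟶ S) (g : S ⟶ T) :
    BurnsideGroup.map (f ≫ g) = (BurnsideGroup.map g).comp (BurnsideGroup.map f) := by
  refine BurnsideGroup.hom_ext fun a => ?_
  rw [AddMonoidHom.comp_apply, BurnsideGroup.map_of, BurnsideGroup.map_of, BurnsideGroup.map_of,
    Category.assoc]

/-- The Burnside Mackey functor `A = 𝒜(*, -)`. -/
noncomputable def burnsideMackey (G : Type u) [Group G] : SetFunctor G where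
  obj T := BurnsideGroup T
  map f := ↾(BurnsideGroup.map f)
  map_id T := by rw [BurnsideGroup.map_id]; rfl
  map_comp f g := by rw [BurnsideGroup.map_comp]; rfl

variable [Finite G]

/-- The finite `G`-set `G/H`. -/
noncomputable def orbit (H : Subgroup G) : FinGSet G :=
  Action.FintypeCat.ofMulAction G (FintypeCat.of (G ⧸ H))

/-- `EF_N(A)(T)`, where `EF_N(A)` is the sub-Mackey functor of `A` generated by the groups `A(G/H)`
for all subgroups `H` that do not contain `N`. -/
noncomputable def subEF (N : Subgroup G) (T : BurnsideCat G) : AddSubgroup (BurnsideGroup T) :=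
  AddSubgroup.closure {y | ∃ (H : Subgroup G) (_ : ¬ N ≤ H)
    (f : (⟨orbit H⟩ : BurnsideCat G) ⟶ T) (x : BurnsideGroup ⟨orbit H⟩),
      y = BurnsideGroup.map f x}

theorem subEF_le_comap (N : Subgroup G) {S T : BurnsideCat G} (f : S ⟶ T) :
    subEF N S ≤ (subEF N T).comap (BurnsideGroup.map f) := by
  refine (AddSubgroup.closure_le _).2 ?_
  rintro _ ⟨H, hH, g, x, rfl⟩
  refine AddSubgroup.subset_closure ⟨H, hH, g ≫ f, x, ?_⟩
  rw [BurnsideGroup.map_comp, AddMonoidHom.comp_apply]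

/-- The quotient Mackey functor `ẼF_N(A) = A / EF_N(A)`. -/
noncomputable def tildeEFA (N : Subgroup G) : SetFunctor G where
  obj T := BurnsideGroup T ⧸ subEF N T
  map f := ↾(QuotientAddGroup.map _ _ (BurnsideGroup.map f) (subEF_le_comap N f))
  map_id T := by
    ext x
    induction x using QuotientAddGroup.induction_on with
    | H x => exact congrArg _ (DFunLike.congr_fun (BurnsideGroup.map_id T) x)
  map_comp f g := by
    ext x
    induction x using QuotientAddGroup.induction_on with
    | H x => exact congrArg _ (DFunLike.congr_fun (BurnsideGroup.map_comp f g) x)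

/-- `ẼF_N(M) = M □ ẼF_N(A)`. -/
noncomputable def tildeEF (N : Subgroup G) : SetFunctor G ⥤ SetFunctor G :=
  Prod.sectL (SetFunctor G) (tildeEFA N) ⋙ box G

/-- The pullback `π_N^*` of functors along the fixed points functor: `(π_N^* X)(T) = X(T^N)`, so
that `π_N^* X` is `X((G/N)/(H/N))` at `G/H` for `N ≤ H` and vanishes at `G/H` otherwise. -/
noncomputable def pullbackπ (N : Subgroup G) [N.Normal] : SetFunctor (G ⧸ N) ⥤ SetFunctor G :=
  (Functor.whiskeringLeft _ _ _).obj (Burnside.map (fixedPts N))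

/-- The geometric fixed points `Φ^N M = (π_N^*)⁻¹ (ẼF_N M)`. As `T^N = T` for a `G/N`-set `T`, the
inverse of `π_N^*` on its image is restriction along inflation. -/
noncomputable def geomFixedPts (N : Subgroup G) [N.Normal] : SetFunctor G ⥤ SetFunctor (G ⧸ N) :=
  tildeEF N ⋙ (Functor.whiskeringLeft _ _ _).obj (Burnside.map (infl N))

/-- If `ẼF_N M` is the pullback of `X`, then `Φ^N M` is `X`. -/
theorem nonempty_geomFixedPts_iso {N : Subgroup G} [N.Normal] {M : SetFunctor G}
    {X : SetFunctor (G ⧸ N)} (e : (pullbackπ N).obj X ≅ (tildeEF N).obj M) :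
    Nonempty ((geomFixedPts N).obj M ≅ X) := by
  let i : Burnside.map (infl N) ⋙ Burnside.map (fixedPts N) ≅ 𝟭 (BurnsideCat (G ⧸ N)) :=
    Burnside.mapCompIso _ _ ≪≫ Burnside.mapNatIso (inflFixedPtsIso N) ≪≫ Burnside.mapIdIso
  exact ⟨Functor.isoWhiskerLeft (Burnside.map (infl N)) e.symm ≪≫
    (Functor.associator _ _ _).symm ≪≫ Functor.isoWhiskerRight i X ≪≫ X.leftUnitor⟩

/-- The norm `N_H^G`: left Kan extension along coinduction. -/
noncomputable def normFunctor (H : Subgroup G) : SetFunctor H ⥤ SetFunctor G :=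
  (Burnside.map (coind H)).lan

/-- The isomorphism `H/(H ∩ N) ≅ HN/N` onto the image of `H` in `G/N`. -/
noncomputable def quotientEquiv (H N : Subgroup G) [N.Normal] :
    H ⧸ N.subgroupOf H ≃* H.map (QuotientGroup.mk' N) :=
  (QuotientGroup.quotientMulEquivOfEq (by
    ext h
    rw [Subgroup.mem_subgroupOf, MonoidHom.mem_ker, ← QuotientGroup.eq_one_iff]
    exact ⟨fun e => Subtype.ext e, fun e => congrArg Subtype.val e⟩)).trans
    (QuotientGroup.quotientKerEquivOfSurjective ((QuotientGroup.mk' N).subgroupMap H)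
      ((QuotientGroup.mk' N).subgroupMap_surjective H))

/-- Regard a functor on the Burnside category of `Q` as one on that of an isomorphic group. -/
noncomputable def transport {Q Q' : Type u} [Group Q] [Group Q'] (e : Q ≃* Q') :
    SetFunctor Q ⥤ SetFunctor Q' :=
  (Functor.whiskeringLeft _ _ _).obj (Burnside.map (Action.res FintypeCat.{u} e.toMonoidHom))

end Mackey

end MackeyNorm

/-!
On Mackey functors, the geometric fixed points `Φ^N` are the left Kan extension along the fixed
point functor `T ↦ T^N` of Burnside categories. Norms are left Kan extensions as well, so both
sides of the comparison are iterated Kan extensions, and these agree because an `N`-fixed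
`H`-equivariant map `G → T` is the same as an `HN/N`-equivariant map `G/N → T^(H ∩ N)`:
`F_H(G, T)^N ≅ F_{HN/N}(G/N, T^(H ∩ N))` (`coindFixedPtsIso`, `normLanIso`).

The description of `Φ^N` (`lanIsoGeomFixedPts`) rests on the fact that `M □ A/EF_N(A)` is the
universal Mackey functor under `M` that vanishes on the finite `G`-sets without `N`-fixed points.
It does vanish there, because a span whose apex has no `N`-fixed points is a sum of spans with
apex `G/J`, where `J` does not contain `N` (`of_span_mem_subEF`, `tildeUnit_eq_zero`). It is
universal, because the groups `A(T)` act on every Mackey functor through the Cartesian product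
(`exists_tildeDesc`). In a Mackey functor of this kind the part of a span away from the fixed
points acts as zero, so restriction along `S^N → S` becomes natural for all spans `S ← U → T`
(`map_resFixedPts_tildeUnit`). This gives the comparison map from the Kan extension to `Φ^N M`.
It is injective because the Kan extension, pulled back along fixed points, vanishes on the
`G`-sets without `N`-fixed points, and so receives a map from `M □ A/EF_N(A)`. It is surjective
because `M □ A/EF_N(A)` is generated as a Mackey functor by the image of `M`.

That all functors involved are Mackey functors has two parts. The left Kan extension of a product
preserving functor to sets along any functor preserves products, since the pair of the classes
`[f₁, x₁]` and `[f₂, x₂]` is represented by `(x₁, x₂)` (`lan_preservesProd`). Negatives are less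
clear, since coinduction is not additive. The element `(x, -x)` of `M(S ⨿ S)` is sent to zero by
the transfer along the fold map `S ⨿ S → S`, and coinduction takes this transfer to the sum of the
coinduced restriction to the first summand, which takes `(x, -x)` to `x`, and some further span
`r`. So `r` takes the class of `(x, -x)` to the negative of the class of `x`
(`lan_groupValued`, `exists_coind_map_tr_codiag`).
-/

set_option linter.unusedSectionVars false

/-! ### Product preservation and left Kan extensions of set-valued functors -/

namespace MackeyNorm

section ProductPreservation

/-- `p₁` and `p₂` exhibit `c` as the product of `c₁` and `c₂`, and `X` preserves this product. -/
structure PreservesProd {C : Type*} [Category* C] (X : C ⥤ Type w) {c c₁ c₂ : C} (p₁ : c ⟶ c₁)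
    (p₂ : c ⟶ c₂) : Prop where
  hom (d : C) : Function.Bijective fun h : d ⟶ c => (h ≫ p₁, h ≫ p₂)
  val : Function.Bijective fun x : X.obj c => (X.map p₁ x, X.map p₂ x)

/-- The object `t` is terminal, and `X(t)` is a point. -/
structure PreservesTerm {C : Type*} [Category* C] (X : C ⥤ Type w) (t : C) : Prop where
  hom (d : C) : Nonempty (Unique (d ⟶ t))
  val : Nonempty (Unique (X.obj t))

/-- The category has a terminal object and binary products, and `X` preserves them. Only one
product of each pair is demanded to be preserved, which is what an explicit construction gives. -/
structure ProdPres {C : Type*} [Category* C] (X : C ⥤ Type w) : Prop where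
  prod (c₁ c₂ : C) : ∃ (c : C) (p₁ : c ⟶ c₁) (p₂ : c ⟶ c₂), PreservesProd X p₁ p₂
  term : ∃ t : C, PreservesTerm X t

end ProductPreservation

section Kan

variable {C D : Type w} [Category.{w} C] [Category.{w} D] (F : C ⥤ D) (X : C ⥤ Type w)

/-- The element of the left Kan extension of `X` along `F` represented by `f : F c ⟶ T` and
`x ∈ X c`. -/
noncomputable def lanMk {c : C} {T : D} (f : F.obj c ⟶ T) (x : X.obj c) : (F.lan.obj X).obj T :=
  (F.lan.obj X).map f ((F.lanUnit.app X).app c x)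

variable {X}

theorem map_lanMk {c : C} {T T' : D} (f : F.obj c ⟶ T) (g : T ⟶ T') (x : X.obj c) :
    (F.lan.obj X).map g (lanMk F X f x) = lanMk F X (f ≫ g) x := by
  simp [lanMk]

theorem lanMk_map {c c' : C} {T : D} (g : c ⟶ c') (f : F.obj c' ⟶ T) (x : X.obj c) :
    lanMk F X f (X.map g x) = lanMk F X (F.map g ≫ f) x := by
  have := ConcreteCategory.congr_hom ((F.lanUnit.app X).naturality g) x
  dsimp at this
  simp [lanMk, this]

/-- Every element of a left Kan extension to sets has a representative, since the extension is
pointwise and its values are colimits of sets. -/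
theorem exists_lanMk {T : D} (z : (F.lan.obj X).obj T) :
    ∃ (c : C) (f : F.obj c ⟶ T) (x : X.obj c), lanMk F X f x = z := by
  have h := F.isPointwiseLeftKanExtensionLeftKanExtensionUnit X T
  obtain ⟨j, y, hy⟩ := Types.jointly_surjective _ h z
  exact ⟨j.left, j.hom, y, by rw [← hy]; rfl⟩

/-- A compatible family of functions on representatives defines a function on the left Kan
extension. -/
theorem exists_lanDesc {T : D} {β : Type w} (φ : ∀ c : C, (F.obj c ⟶ T) → X.obj c → β)
    (hφ : ∀ (c c' : C) (g : c ⟶ c') (f : F.obj c' ⟶ T) (x : X.obj c),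
      φ c (F.map g ≫ f) x = φ c' f (X.map g x)) :
    ∃ ψ : (F.lan.obj X).obj T → β, ∀ (c : C) (f : F.obj c ⟶ T) (x : X.obj c),
      ψ (lanMk F X f x) = φ c f x := by
  have h := F.isPointwiseLeftKanExtensionLeftKanExtensionUnit X T
  let s : Cocone (CostructuredArrow.proj F T ⋙ X) :=
    { pt := β
      ι :=
        { app j := ↾(φ j.left j.hom)
          naturality j j' g := by
            ext x
            have e := hφ j.left j'.left g.left j'.hom x
            rw [CostructuredArrow.w g] at e
            exact e.symm } }
  refine ⟨h.desc s, fun c f x => ?_⟩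
  exact ConcreteCategory.congr_hom (h.fac s (CostructuredArrow.mk f)) x

/-- A natural transformation out of the left Kan extension, on representatives. -/
theorem lan_app_lanMk {Y : D ⥤ Type w} (φ : F.lan.obj X ⟶ Y) {c : C} {T : D} (f : F.obj c ⟶ T)
    (x : X.obj c) : φ.app T (lanMk F X f x) = Y.map f (φ.app _ ((F.lanUnit.app X).app c x)) := by
  have := ConcreteCategory.congr_hom (φ.naturality f) ((F.lanUnit.app X).app c x)
  exact this

/-- The left Kan extension, along an arbitrary functor, of a product preserving functor to sets
preserves products. The pair of `[f₁, x₁]` and `[f₂, x₂]` is represented by `(x₁, x₂)`. -/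
theorem lan_preservesProd (hX : ProdPres X) {d d₁ d₂ : D} {q₁ : d ⟶ d₁} {q₂ : d ⟶ d₂}
    (hq : ∀ e : D, Function.Bijective fun h : e ⟶ d => (h ≫ q₁, h ≫ q₂)) :
    PreservesProd (F.lan.obj X) q₁ q₂ := by
  refine ⟨hq, ?_⟩
  let L := F.lan.obj X
  choose P p₁ p₂ hP using hX.prod
  choose pr hpr using fun (e : D) (f : (e ⟶ d₁) × (e ⟶ d₂)) => (hq e).2 f
  choose px hpx using fun (c₁ c₂ : C) (x : X.obj c₁ × X.obj c₂) => (hP c₁ c₂).val.2 x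
  have hpr₁ e f : pr e f ≫ q₁ = f.1 := congrArg Prod.fst (hpr e f)
  have hpr₂ e f : pr e f ≫ q₂ = f.2 := congrArg Prod.snd (hpr e f)
  have hpx₁ c₁ c₂ x : X.map (p₁ c₁ c₂) (px c₁ c₂ x) = x.1 := congrArg Prod.fst (hpx c₁ c₂ x)
  have hpx₂ c₁ c₂ x : X.map (p₂ c₁ c₂) (px c₁ c₂ x) = x.2 := congrArg Prod.snd (hpx c₁ c₂ x)
  have prext {e : D} {f g : e ⟶ d} (h₁ : f ≫ q₁ = g ≫ q₁) (h₂ : f ≫ q₂ = g ≫ q₂) : f = g :=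
    (hq e).1 (Prod.ext h₁ h₂)
  -- the pair of the classes of `(f₁, x₁)` and `(f₂, x₂)`, which is to be the inverse
  let A (c₁ c₂ : C) (f₁ : F.obj c₁ ⟶ d₁) (f₂ : F.obj c₂ ⟶ d₂) (x₁ : X.obj c₁) (x₂ : X.obj c₂) :
      L.obj d :=
    lanMk F X (pr _ (F.map (p₁ c₁ c₂) ≫ f₁, F.map (p₂ c₁ c₂) ≫ f₂)) (px c₁ c₂ (x₁, x₂))
  -- any cone over `c₁` and `c₂` computes the pair, not only their chosen product
  have key (c c₁ c₂ : C) (g₁ : c ⟶ c₁) (g₂ : c ⟶ c₂) (f₁ : F.obj c₁ ⟶ d₁)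
      (f₂ : F.obj c₂ ⟶ d₂) (x : X.obj c) :
      A c₁ c₂ f₁ f₂ (X.map g₁ x) (X.map g₂ x) =
        lanMk F X (pr _ (F.map g₁ ≫ f₁, F.map g₂ ≫ f₂)) x := by
    obtain ⟨h, hh⟩ := ((hP c₁ c₂).hom c).2 (g₁, g₂)
    obtain ⟨rfl, rfl⟩ := Prod.mk.inj hh
    have : px c₁ c₂ (X.map (h ≫ p₁ c₁ c₂) x, X.map (h ≫ p₂ c₁ c₂) x) = X.map h x := by
      apply (hP c₁ c₂).val.1
      ext
      · simp [hpx₁]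
      · simp [hpx₂]
    simp only [A, this, lanMk_map]
    congr 1
    apply prext
    · simp [hpr₁]
    · simp [hpr₂]
  have hA₁ (c₁ c₁' c₂ : C) (g : c₁ ⟶ c₁') (f₁ : F.obj c₁' ⟶ d₁) (f₂ : F.obj c₂ ⟶ d₂)
      (x₁ : X.obj c₁) (x₂ : X.obj c₂) :
      A c₁ c₂ (F.map g ≫ f₁) f₂ x₁ x₂ = A c₁' c₂ f₁ f₂ (X.map g x₁) x₂ := by
    have := key (P c₁ c₂) c₁' c₂ (p₁ _ _ ≫ g) (p₂ _ _) f₁ f₂ (px c₁ c₂ (x₁, x₂))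
    simpa [hpx₁, hpx₂, A] using this.symm
  have hA₂ (c₁ c₂ c₂' : C) (g : c₂ ⟶ c₂') (f₁ : F.obj c₁ ⟶ d₁) (f₂ : F.obj c₂' ⟶ d₂)
      (x₁ : X.obj c₁) (x₂ : X.obj c₂) :
      A c₁ c₂ f₁ (F.map g ≫ f₂) x₁ x₂ = A c₁ c₂' f₁ f₂ x₁ (X.map g x₂) := by
    have := key (P c₁ c₂) c₁ c₂' (p₁ _ _) (p₂ _ _ ≫ g) f₁ f₂ (px c₁ c₂ (x₁, x₂))
    simpa [hpx₁, hpx₂, A] using this.symm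
  -- descend `A` to classes, first in the second variable and then in the first
  choose ψ₂ hψ₂ using fun (c₁ : C) (f₁ : F.obj c₁ ⟶ d₁) (x₁ : X.obj c₁) =>
    exists_lanDesc F (fun c₂ f₂ x₂ => A c₁ c₂ f₁ f₂ x₁ x₂)
      (fun c₂ c₂' g f₂ x₂ => hA₂ c₁ c₂ c₂' g f₁ f₂ x₁ x₂)
  obtain ⟨ψ, hψ⟩ := exists_lanDesc (T := d₁) F (fun c₁ f₁ x₁ => ψ₂ c₁ f₁ x₁)
    (fun c₁ c₁' g f₁ x₁ => by
      funext z
      obtain ⟨c₂, f₂, x₂, rfl⟩ := exists_lanMk F z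
      rw [hψ₂, hψ₂]
      exact hA₁ c₁ c₁' c₂ g f₁ f₂ x₁ x₂)
  refine Function.bijective_iff_has_inverse.2 ⟨fun y => ψ y.1 y.2, fun z => ?_, fun y => ?_⟩
  · obtain ⟨c, f, x, rfl⟩ := exists_lanMk F z
    simp only [map_lanMk, hψ, hψ₂]
    have := key c c c (𝟙 _) (𝟙 _) (f ≫ q₁) (f ≫ q₂) x
    have e : X.map (𝟙 c) x = x := by simp
    rw [e] at this
    rw [this]
    congr 1
    apply prext
    · simp [hpr₁]
    · simp [hpr₂]
  · obtain ⟨y₁, y₂⟩ := y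
    obtain ⟨c₁, f₁, x₁, rfl⟩ := exists_lanMk F y₁
    obtain ⟨c₂, f₂, x₂, rfl⟩ := exists_lanMk F y₂
    simp only [hψ, hψ₂, A, map_lanMk, hpr₁, hpr₂, ← lanMk_map, hpx₁, hpx₂]

theorem lan_preservesTerm (hX : ProdPres X) {t : D} (ht : ∀ d : D, Nonempty (Unique (d ⟶ t))) :
    PreservesTerm (F.lan.obj X) t := by
  refine ⟨ht, ?_⟩
  obtain ⟨s, hs, ⟨hsX⟩⟩ := hX.term
  have f : F.obj s ⟶ t := (ht _).some.default
  refine ⟨⟨⟨lanMk F X f hsX.default⟩, fun z => ?_⟩⟩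
  obtain ⟨c, g, x, rfl⟩ := exists_lanMk F z
  have e : g = F.map ((hs c).some.default) ≫ f := (ht _).some.instSubsingleton.elim _ _
  rw [e, ← lanMk_map]
  congr 1
  exact hsX.instSubsingleton.elim _ _

end Kan

end MackeyNorm

/-! ### Biproducts in the Burnside category -/

namespace MackeyNorm

section ProductPreservation

variable {C : Type u} [Category.{v} C] {X : C ⥤ Type w}

theorem isLimit_binaryFan_of_bijective {c c₁ c₂ : C} {p₁ : c ⟶ c₁} {p₂ : c ⟶ c₂}
    (h : ∀ d : C, Function.Bijective fun h : d ⟶ c => (h ≫ p₁, h ≫ p₂)) :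
    Nonempty (IsLimit (BinaryFan.mk p₁ p₂)) := by
  choose l hl using fun (d : C) (f : (d ⟶ c₁) × (d ⟶ c₂)) => (h d).2 f
  exact ⟨BinaryFan.IsLimit.mk _ (fun {d} f g => l d (f, g))
    (fun {d} f g => congrArg Prod.fst (hl d (f, g)))
    (fun {d} f g => congrArg Prod.snd (hl d (f, g)))
    (fun {d} f g m h₁ h₂ => (h d).1 ((Prod.ext h₁ h₂).trans (hl d (f, g)).symm))⟩

/-- Products of sets, recognized by elements. -/
theorem nonempty_isLimit_binaryFan_iff_bijective {A B P : Type w} (f : P ⟶ A) (g : P ⟶ B) :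
    Nonempty (IsLimit (BinaryFan.mk f g)) ↔ Function.Bijective fun x : P => (f x, g x) := by
  constructor
  · rintro ⟨h⟩
    let e := (h.conePointUniqueUpToIso (Types.binaryProductLimit A B)).toEquiv
    have h₁ (x : P) : (e x).1 = f x := by
      have := ConcreteCategory.congr_hom
        (h.conePointUniqueUpToIso_hom_comp (Types.binaryProductLimit A B) ⟨WalkingPair.left⟩) x
      exact this
    have h₂ (x : P) : (e x).2 = g x := by
      have := ConcreteCategory.congr_hom
        (h.conePointUniqueUpToIso_hom_comp (Types.binaryProductLimit A B) ⟨WalkingPair.right⟩) x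
      exact this
    have : (fun x : P => (f x, g x)) = e := funext fun x => Prod.ext (h₁ x).symm (h₂ x).symm
    rw [this]
    exact e.bijective
  · intro h
    refine isLimit_binaryFan_of_bijective fun D => ⟨fun a b hab => ?_, fun a => ?_⟩
    · ext x
      apply h.1
      exact Prod.ext (ConcreteCategory.congr_hom (congrArg Prod.fst hab) x)
        (ConcreteCategory.congr_hom (congrArg Prod.snd hab) x)
    · choose l hl using fun d : D => h.2 (a.1 d, a.2 d)
      refine ⟨↾l, Prod.ext ?_ ?_⟩
      · ext d
        exact congrArg Prod.fst (hl d)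
      · ext d
        exact congrArg Prod.snd (hl d)

theorem bijective_of_preservesFiniteProducts [PreservesFiniteProducts X] {c c₁ c₂ : C}
    {p₁ : c ⟶ c₁} {p₂ : c ⟶ c₂}
    (h : ∀ d : C, Function.Bijective fun h : d ⟶ c => (h ≫ p₁, h ≫ p₂)) :
    Function.Bijective fun x : X.obj c => (X.map p₁ x, X.map p₂ x) := by
  obtain ⟨hl⟩ := isLimit_binaryFan_of_bijective h
  exact (nonempty_isLimit_binaryFan_iff_bijective _ _).1
    ⟨isLimitMapConeBinaryFanEquiv X _ _ (isLimitOfPreserves X hl)⟩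

theorem nonempty_unique_of_preservesFiniteProducts [PreservesFiniteProducts X] {t : C}
    (h : ∀ d : C, Nonempty (Unique (d ⟶ t))) : Nonempty (Unique (X.obj t)) := by
  have ht : IsTerminal t := IsTerminal.ofUniqueHom (fun d => (h d).some.default)
    (fun d m => (h d).some.uniq m)
  have := IsTerminal.isTerminalObj X t ht
  exact ⟨(Types.isTerminalEquivUnique _ this)⟩

theorem ProdPres.hasFiniteProducts (hX : ProdPres X) : HasFiniteProducts C := by
  have : HasBinaryProducts C := by
    have (A B : C) : HasLimit (pair A B) := by
      obtain ⟨c, p₁, p₂, h⟩ := hX.prod A B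
      obtain ⟨hl⟩ := isLimit_binaryFan_of_bijective h.hom
      exact ⟨⟨_, hl⟩⟩
    exact hasBinaryProducts_of_hasLimit_pair C
  have : HasTerminal C := by
    obtain ⟨t, ht⟩ := hX.term
    exact (IsTerminal.ofUniqueHom (fun d => (ht.hom d).some.default)
      (fun d m => (ht.hom d).some.uniq m)).hasTerminal
  exact hasFiniteProducts_of_has_binary_and_terminal

theorem ProdPres.preservesFiniteProducts (hX : ProdPres X) : PreservesFiniteProducts X := by
  have := hX.hasFiniteProducts
  have : PreservesLimitsOfShape (Discrete WalkingPair) X := by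
    have (A B : C) : PreservesLimit (pair A B) X := by
      obtain ⟨c, p₁, p₂, h⟩ := hX.prod A B
      obtain ⟨hl⟩ := isLimit_binaryFan_of_bijective h.hom
      obtain ⟨hl'⟩ := (nonempty_isLimit_binaryFan_iff_bijective _ _).2 h.val
      exact preservesLimit_of_preserves_limit_cone hl
        ((isLimitMapConeBinaryFanEquiv X _ _).symm hl')
    exact ⟨fun {K} => preservesLimit_of_iso_diagram X (diagramIsoPair K).symm⟩
  have : PreservesLimitsOfShape (Discrete PEmpty.{1}) X := by
    obtain ⟨t, ht⟩ := hX.term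
    have h : IsTerminal t := IsTerminal.ofUniqueHom (fun d => (ht.hom d).some.default)
      (fun d m => (ht.hom d).some.uniq m)
    have h' : IsTerminal (X.obj t) := (Types.isTerminalEquivUnique _).symm ht.val.some
    have : PreservesLimit (Functor.empty C) X :=
      preservesLimit_of_preserves_limit_cone h ((isLimitMapConeEmptyConeEquiv X t).symm h')
    exact preservesLimitsOfShape_pempty_of_preservesTerminal X
  exact PreservesFiniteProducts.of_preserves_binary_and_terminal X

end ProductPreservation

namespace Burnside

variable {C : Type u} [Category.{v} C] [HasPullbacks C]

theorem tr_comp_tr {X Y Z : C} (f : X ⟶ Y) (g : Y ⟶ Z) : tr f ≫ tr g = tr (f ≫ g) :=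
  (span_comp (p := 𝟙 _) (q := f) (IsPullback.of_horiz_isIso ⟨by simp⟩)).trans (by simp [tr])

theorem res_comp_res {X Y Z : C} (f : X ⟶ Y) (g : Y ⟶ Z) : res g ≫ res f = res (f ≫ g) :=
  (span_comp (p := f) (q := 𝟙 _) (IsPullback.of_vert_isIso ⟨by simp⟩)).trans (by simp [res])

/-- Every span is a restriction followed by a transfer. -/
theorem res_comp_tr {X Y U : C} (l : U ⟶ X) (r : U ⟶ Y) : res l ≫ tr r = span l r :=
  (span_comp (p := 𝟙 _) (q := 𝟙 _) (IsPullback.of_vert_isIso ⟨by simp⟩)).trans (by simp)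

theorem span_comp_tr {X Y Z U : C} (l : U ⟶ X) (r : U ⟶ Y) (f : Y ⟶ Z) :
    span l r ≫ tr f = span l (r ≫ f) := by
  rw [← res_comp_tr, Category.assoc, tr_comp_tr, res_comp_tr]

theorem res_comp_span {X Y Z U : C} (f : X ⟶ Z) (l : U ⟶ X) (r : U ⟶ Y) :
    res f ≫ span l r = span (l ≫ f) r := by
  rw [← res_comp_tr, ← Category.assoc, res_comp_res, res_comp_tr]

/-- Restriction to a subobject undoes the transfer from it: the pullback of a monomorphism along
itself is its source. -/
theorem tr_comp_res_of_mono {X Y : C} (f : X ⟶ Y) [Mono f] : tr f ≫ res f = 𝟙 _ :=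
  (span_comp (p := 𝟙 _) (q := 𝟙 _) (IsKernelPair.id_of_mono f)).trans (by simp [id_eq_span])

section Additive

variable [FinitaryExtensive C]

/-- A span whose apex is a coproduct is the sum of its restrictions. -/
theorem span_eq_add {X Y U V W : C} {i : U ⟶ W} {j : V ⟶ W} (h : IsColimit (BinaryCofan.mk i j))
    (l : W ⟶ X) (r : W ⟶ Y) : span l r = span (i ≫ l) (i ≫ r) + span (j ≫ l) (j ≫ r) := by
  let e : U ⨿ V ≅ W := (coprodIsCoprod U V).coconePointUniqueUpToIso h
  have e₁ : coprod.inl ≫ e.hom = i :=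
    (coprodIsCoprod U V).comp_coconePointUniqueUpToIso_hom h ⟨WalkingPair.left⟩
  have e₂ : coprod.inr ≫ e.hom = j :=
    (coprodIsCoprod U V).comp_coconePointUniqueUpToIso_hom h ⟨WalkingPair.right⟩
  rw [span_add]
  refine (span_eq e ?_ ?_).symm <;> apply coprod.hom_ext <;>
    simp [coprod.inl_desc, coprod.inr_desc, reassoc_of% e₁, reassoc_of% e₂]

theorem span_eq_zero {X Y W : C} (h : IsInitial W) (l : W ⟶ X) (r : W ⟶ Y) : span l r = 0 := by
  rw [zero_eq_span]
  exact span_eq (h.uniqueUpToIso initialIsInitial) (h.hom_ext _ _) (h.hom_ext _ _)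

theorem comp_add {X Y Z : Burnside C} (a : X ⟶ Y) (b c : Y ⟶ Z) :
    a ≫ (b + c) = a ≫ b + a ≫ c := by
  obtain ⟨X⟩ := X
  obtain ⟨Y⟩ := Y
  obtain ⟨Z⟩ := Z
  induction a using hom_ind with
  | h U l r =>
  induction b using hom_ind with
  | h V l₁ r₁ =>
  induction c using hom_ind with
  | h W l₂ r₂ =>
    have h := IsPullback.of_hasPullback r l₁
    have h' := IsPullback.of_hasPullback r l₂
    rw [span_add, span_comp h, span_comp h', span_add,
      span_comp (isPullback_coprodDesc h.flip h'.flip).flip, coprod.map_desc, coprod.desc_comp]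

theorem comp_zero {X Y Z : Burnside C} (a : X ⟶ Y) : a ≫ (0 : Y ⟶ Z) = 0 := by
  obtain ⟨X⟩ := X
  obtain ⟨Y⟩ := Y
  obtain ⟨Z⟩ := Z
  induction a using hom_ind with
  | h U l r =>
    rw [zero_eq_span, span_comp (isPullback_initial r).flip, zero_eq_span]
    congr 1 <;> exact initial.hom_ext _ _

/-- Summands are disjoint, so transfer from one followed by restriction to the other is zero. -/
theorem tr_inl_res_inr (S T : C) :
    tr (coprod.inl : S ⟶ S ⨿ T) ≫ res (coprod.inr : T ⟶ S ⨿ T) = 0 := by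
  refine (span_comp
    (FinitaryExtensive.isPullback_initial_to_binaryCofan (coprodIsCoprod S T))).trans ?_
  exact span_eq_zero initialIsInitial _ _

theorem tr_inr_res_inl (S T : C) :
    tr (coprod.inr : T ⟶ S ⨿ T) ≫ res (coprod.inl : S ⟶ S ⨿ T) = 0 := by
  refine (span_comp
    (FinitaryExtensive.isPullback_initial_to_binaryCofan (coprodIsCoprod S T)).flip).trans ?_
  exact span_eq_zero initialIsInitial _ _

theorem tr_inl_res_inl (S T : C) :
    tr (coprod.inl : S ⟶ S ⨿ T) ≫ res (coprod.inl : S ⟶ S ⨿ T) = 𝟙 _ := tr_comp_res_of_mono _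

theorem tr_inr_res_inr (S T : C) :
    tr (coprod.inr : T ⟶ S ⨿ T) ≫ res (coprod.inr : T ⟶ S ⨿ T) = 𝟙 _ := tr_comp_res_of_mono _

theorem res_tr_add (S T : C) :
    res (coprod.inl : S ⟶ S ⨿ T) ≫ tr coprod.inl + res (coprod.inr : T ⟶ S ⨿ T) ≫ tr coprod.inr =
      𝟙 _ := by
  rw [res_comp_tr, res_comp_tr, span_add, id_eq_span]
  congr 1 <;> ext <;> simp

/-- The transfer along the fold map is the sum of the two restrictions, so it is the addition of
the values of a product preserving functor. -/
theorem tr_codiag (S : C) : tr (coprod.desc (𝟙 S) (𝟙 S)) = res coprod.inl + res coprod.inr := by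
  rw [tr, span_eq_add (coprodIsCoprod S S)]
  simp [res, coprod.inl_desc, coprod.inr_desc]

/-- Coproducts in `C` are products in the Burnside category. -/
theorem coprod_bijective (S T : C) (R : Burnside C) : Function.Bijective
    fun h : R ⟶ ⟨S ⨿ T⟩ => (h ≫ res (coprod.inl : S ⟶ S ⨿ T), h ≫ res coprod.inr) := by
  refine Function.bijective_iff_has_inverse.2
    ⟨fun f => f.1 ≫ tr coprod.inl + f.2 ≫ tr coprod.inr, fun f => ?_, fun f => ?_⟩
  · simp only [Category.assoc, ← comp_add, res_tr_add, Category.comp_id]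
  · ext
    · simp only [add_comp, Category.assoc, tr_inl_res_inl, tr_inr_res_inl, comp_zero, add_zero,
        Category.comp_id]
    · simp only [add_comp, Category.assoc, tr_inl_res_inr, tr_inr_res_inr, comp_zero, zero_add,
        Category.comp_id]

/-- An initial object of `C` is terminal in the Burnside category: a span to it has an initial
apex, as initial objects are strict. -/
theorem initial_unique (R : Burnside C) : Nonempty (Unique (R ⟶ ⟨⊥_ C⟩)) := by
  obtain ⟨R⟩ := R
  refine ⟨⟨⟨0⟩, fun a => ?_⟩⟩
  induction a using hom_ind with
  | h U l r =>
    have : IsIso r := initialIsInitial.isIso_to r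
    exact span_eq_zero (initialIsInitial.ofIso (asIso r).symm) l r

theorem prodPres_of_preservesFiniteProducts (X : Burnside C ⥤ Type w)
    [PreservesFiniteProducts X] : ProdPres X where
  prod S T := ⟨⟨S.as ⨿ T.as⟩, res coprod.inl, res coprod.inr, coprod_bijective _ _,
    bijective_of_preservesFiniteProducts (coprod_bijective _ _)⟩
  term := ⟨⟨⊥_ C⟩, initial_unique, nonempty_unique_of_preservesFiniteProducts initial_unique⟩

end Additive

end Burnside

end MackeyNorm

/-! ### Values as commutative monoids; group-valued functors -/

namespace MackeyNorm

namespace Burnside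

variable {C : Type u} [Category.{v} C] [HasPullbacks C] [FinitaryExtensive C]

section AddCommMonoid

variable (X : Burnside C ⥤ Type w) [PreservesFiniteProducts X]

/-- Two elements are restrictions of a single one. This reduces identities in the values of `X` to
identities of morphisms of the Burnside category. -/
theorem exists_pair {S T : Burnside C} (x : X.obj S) (y : X.obj T) :
    ∃ (R : Burnside C) (p : R ⟶ S) (q : R ⟶ T) (z : X.obj R), X.map p z = x ∧ X.map q z = y := by
  obtain ⟨z, hz⟩ := (bijective_of_preservesFiniteProducts (X := X) (coprod_bijective S.as T.as)).2
    (x, y)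
  exact ⟨_, _, _, z, congrArg Prod.fst hz, congrArg Prod.snd hz⟩

variable {X} in
/-- The element of `X(T ⨿ T)` that restricts to `x` and to `y`. -/
noncomputable def pair {T : Burnside C} (x y : X.obj T) : X.obj ⟨T.as ⨿ T.as⟩ :=
  ((bijective_of_preservesFiniteProducts (X := X) (coprod_bijective T.as T.as)).2 (x, y)).choose

variable {X} in
theorem map_inl_pair {T : Burnside C} (x y : X.obj T) : X.map (res coprod.inl) (pair x y) = x :=
  congrArg Prod.fst
    ((bijective_of_preservesFiniteProducts (X := X) (coprod_bijective T.as T.as)).2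
      (x, y)).choose_spec

variable {X} in
theorem map_inr_pair {T : Burnside C} (x y : X.obj T) : X.map (res coprod.inr) (pair x y) = y :=
  congrArg Prod.snd
    ((bijective_of_preservesFiniteProducts (X := X) (coprod_bijective T.as T.as)).2
      (x, y)).choose_spec

variable {X} in
theorem eq_pair {T : Burnside C} {x y : X.obj T} {z : X.obj ⟨T.as ⨿ T.as⟩}
    (h₁ : X.map (res coprod.inl) z = x) (h₂ : X.map (res coprod.inr) z = y) : z = pair x y :=
  (bijective_of_preservesFiniteProducts (X := X) (coprod_bijective T.as T.as)).1
    (Prod.ext (h₁.trans (map_inl_pair x y).symm) (h₂.trans (map_inr_pair x y).symm))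

/-- Addition in `X(T)` is the transfer along the fold map `T ⨿ T ⟶ T`. -/
noncomputable instance (T : Burnside C) : Add (X.obj T) where
  add x y := X.map (tr (coprod.desc (𝟙 T.as) (𝟙 T.as))) (pair x y)

noncomputable instance (T : Burnside C) : Zero (X.obj T) where
  zero := X.map (0 : (⟨⊥_ C⟩ : Burnside C) ⟶ T)
    (nonempty_unique_of_preservesFiniteProducts (X := X) initial_unique).some.default

variable {X}

theorem add_def {T : Burnside C} (x y : X.obj T) :
    x + y = X.map (tr (coprod.desc (𝟙 T.as) (𝟙 T.as))) (pair x y) := rfl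

theorem map_add_apply {S T : Burnside C} (f g : S ⟶ T) (x : X.obj S) :
    X.map (f + g) x = X.map f x + X.map g x := by
  obtain ⟨h, hh⟩ := (coprod_bijective T.as T.as S).2 (f, g)
  obtain ⟨rfl, rfl⟩ := Prod.mk.inj hh
  rw [← comp_add, ← tr_codiag, add_def, Functor.map_comp]
  refine congrArg _ (eq_pair ?_ ?_) <;> exact (Functor.map_comp_apply X _ _ x).symm

theorem map_zero_apply {S T : Burnside C} (x : X.obj S) : X.map (0 : S ⟶ T) x = 0 := by
  have h : X.map (0 : S ⟶ ⟨⊥_ C⟩) x =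
      (nonempty_unique_of_preservesFiniteProducts (X := X) initial_unique).some.default :=
    (nonempty_unique_of_preservesFiniteProducts (X := X)
      initial_unique).some.instSubsingleton.elim _ _
  change _ = X.map _ _
  rw [← h, ← zero_comp (X := S) (0 : (⟨⊥_ C⟩ : Burnside C) ⟶ T), Functor.map_comp]
  rfl

noncomputable instance (T : Burnside C) : AddCommMonoid (X.obj T) where
  add_assoc x y z := by
    obtain ⟨R, p, q, w, rfl, rfl⟩ := exists_pair X x y
    obtain ⟨R', p', q', w', rfl, rfl⟩ := exists_pair X w z
    simp only [← Functor.map_comp_apply, ← map_add_apply, add_assoc]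
  zero_add x := by
    have h := map_add_apply (X := X) 0 (𝟙 T) x
    rw [zero_add, map_zero_apply, Functor.map_id_apply X T x] at h
    exact h.symm
  add_zero x := by
    have h := map_add_apply (X := X) (𝟙 T) 0 x
    rw [add_zero, map_zero_apply, Functor.map_id_apply X T x] at h
    exact h.symm
  add_comm x y := by
    obtain ⟨R, p, q, w, rfl, rfl⟩ := exists_pair X x y
    rw [← map_add_apply, ← map_add_apply, add_comm]
  nsmul := nsmulRec

theorem map_apply_add {S T : Burnside C} (f : S ⟶ T) (x y : X.obj S) :
    X.map f (x + y) = X.map f x + X.map f y := by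
  obtain ⟨R, p, q, w, rfl, rfl⟩ := exists_pair X x y
  simp only [← Functor.map_comp_apply, ← map_add_apply, add_comp]

theorem map_apply_zero {S T : Burnside C} (f : S ⟶ T) : X.map f 0 = 0 := by
  rw [← map_zero_apply (T := S) (0 : X.obj S), ← Functor.map_comp_apply, zero_comp,
    map_zero_apply]

theorem app_add {Y : Burnside C ⥤ Type w} [PreservesFiniteProducts Y] (φ : X ⟶ Y)
    {T : Burnside C} (x y : X.obj T) : φ.app T (x + y) = φ.app T x + φ.app T y := by
  obtain ⟨R, p, q, w, rfl, rfl⟩ := exists_pair X x y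
  simp only [← map_add_apply, NatTrans.naturality_apply]

end AddCommMonoid

/-- A product preserving functor on the Burnside category whose values are groups: each `x` is the
first component of an element of `X(T ⨿ T)` whose two components add up to zero. -/
class GroupValued (X : Burnside C ⥤ Type w) : Prop where
  preservesFiniteProducts : PreservesFiniteProducts X
  exists_neg (T : C) (x : X.obj ⟨T⟩) : ∃ z : X.obj ⟨T ⨿ T⟩, X.map (res coprod.inl) z = x ∧
    X.map (tr (coprod.desc (𝟙 T) (𝟙 T))) z = X.map 0 x

attribute [instance] GroupValued.preservesFiniteProducts

theorem GroupValued.exists_add_eq_zero (X : Burnside C ⥤ Type w) [GroupValued X] {T : Burnside C}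
    (x : X.obj T) : ∃ y : X.obj T, x + y = 0 := by
  obtain ⟨z, hz, hz'⟩ := GroupValued.exists_neg T.as x
  refine ⟨X.map (res coprod.inr) z, ?_⟩
  rw [← map_zero_apply (T := T) x]
  refine Eq.trans ?_ hz'
  rw [add_def]
  exact congrArg _ (eq_pair hz rfl).symm

theorem GroupValued.of_exists_add_eq_zero {X : Burnside C ⥤ Type w} [PreservesFiniteProducts X]
    (h : ∀ (T : Burnside C) (x : X.obj T), ∃ y : X.obj T, x + y = 0) : GroupValued X where
  preservesFiniteProducts := inferInstance
  exists_neg T x := by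
    obtain ⟨y, hy⟩ := h _ x
    exact ⟨pair x y, map_inl_pair x y, hy.trans (map_zero_apply x).symm⟩

noncomputable instance (X : Burnside C ⥤ Type w) [GroupValued X] (T : Burnside C) :
    Neg (X.obj T) where
  neg x := (GroupValued.exists_add_eq_zero X x).choose

noncomputable instance (X : Burnside C ⥤ Type w) [GroupValued X] (T : Burnside C) :
    AddCommGroup (X.obj T) where
  zsmul := zsmulRec
  neg_add_cancel x := by
    rw [add_comm]
    exact (GroupValued.exists_add_eq_zero X x).choose_spec
  add_comm := add_comm

/-- A functor to sets that is additive for some group structures on its values preserves products,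
and its values are groups. -/
theorem GroupValued.of_additive {X : Burnside C ⥤ Type w} [∀ T, AddCommGroup (X.obj T)]
    (h : ∀ {S T : Burnside C} (f : S ⟶ T) (x y : X.obj S),
      X.map f (x + y) = X.map f x + X.map f y)
    (h' : ∀ {S T : Burnside C} (f g : S ⟶ T) (x : X.obj S),
      X.map (f + g) x = X.map f x + X.map g x) : GroupValued X := by
  -- in a group, `0 + 0 = 0` for morphisms makes the zero morphism act as zero
  have h₀ {S T : Burnside C} (x : X.obj S) : X.map (0 : S ⟶ T) x = 0 := by
    have := h' (0 : S ⟶ T) 0 x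
    rwa [add_zero, left_eq_add] at this
  have hcomp {R S T : Burnside C} (f : R ⟶ S) (g : S ⟶ T) (x : X.obj R) :
      X.map g (X.map f x) = X.map (f ≫ g) x := by simp
  have hid {S : Burnside C} (x : X.obj S) : X.map (𝟙 S) x = x := by simp
  have hl {S T : C} (x : X.obj ⟨S⟩) (y : X.obj ⟨T⟩) :
      X.map (res coprod.inl) (X.map (tr coprod.inl) x + X.map (tr coprod.inr) y) = x := by
    rw [h, hcomp, hcomp, tr_inl_res_inl, tr_inr_res_inl, hid, h₀, add_zero]
  have hr {S T : C} (x : X.obj ⟨S⟩) (y : X.obj ⟨T⟩) :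
      X.map (res coprod.inr) (X.map (tr coprod.inl) x + X.map (tr coprod.inr) y) = y := by
    rw [h, hcomp, hcomp, tr_inl_res_inr, tr_inr_res_inr, hid, h₀, zero_add]
  constructor
  · refine ProdPres.preservesFiniteProducts
      ⟨fun S T => ⟨_, res coprod.inl, res coprod.inr, coprod_bijective S.as T.as, ?_⟩,
        ⟨⟨⊥_ C⟩, initial_unique, ?_⟩⟩
    · refine Function.bijective_iff_has_inverse.2
        ⟨fun y => X.map (tr coprod.inl) y.1 + X.map (tr coprod.inr) y.2, fun z => ?_, fun y => ?_⟩
      · simp only [hcomp]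
        rw [← h', res_tr_add, hid]
      · exact Prod.ext (hl _ _) (hr _ _)
    · refine ⟨⟨⟨0⟩, fun x => ?_⟩⟩
      obtain ⟨i⟩ := initial_unique (⟨⊥_ C⟩ : Burnside C)
      rw [← hid x, ← h₀ (S := ⟨⊥_ C⟩) x, i.instSubsingleton.elim (𝟙 _) 0]
      rfl
  · intro T x
    refine ⟨X.map (tr coprod.inl) x + X.map (tr coprod.inr) (-x), hl _ _, ?_⟩
    rw [h, hcomp, hcomp, tr_comp_tr, tr_comp_tr, coprod.inl_desc, coprod.inr_desc, ← h, h₀,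
      add_neg_cancel]
    have := h (tr (𝟙 T)) 0 0
    rwa [add_zero, left_eq_add] at this

/-- A functor between Burnside categories that preserves sums of spans. -/
class Additive {D : Type*} [Category* D] [HasPullbacks D] [FinitaryExtensive D]
    (F : Burnside C ⥤ Burnside D) : Prop where
  map_add {S T : Burnside C} (f g : S ⟶ T) : F.map (f + g) = F.map f + F.map g

instance {D : Type*} [Category* D] [HasPullbacks D] [FinitaryExtensive D]
    (F : Burnside C ⥤ Burnside D) [Additive F] (X : Burnside D ⥤ Type w) [GroupValued X] :
    GroupValued (F ⋙ X) :=
  letI (T : Burnside C) : AddCommGroup ((F ⋙ X).obj T) :=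
    inferInstanceAs (AddCommGroup (X.obj (F.obj T)))
  GroupValued.of_additive (fun f x y => map_apply_add (X := X) (F.map f) x y)
    (fun f g x => by
      change X.map (F.map (f + g)) x = _
      rw [Additive.map_add]
      exact map_add_apply (X := X) _ _ x)

/-- Addition in the values of `F ⋙ X`, which is defined by the coproducts of `C`, is addition in
the values of `X`, which is defined by those of `D`. -/
theorem comp_obj_add {D : Type*} [Category* D] [HasPullbacks D] [FinitaryExtensive D]
    (F : Burnside C ⥤ Burnside D) [Additive F] (X : Burnside D ⥤ Type w) [GroupValued X]
    {T : Burnside C} (x y : X.obj (F.obj T)) :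
    (HAdd.hAdd (α := (F ⋙ X).obj T) (β := (F ⋙ X).obj T) x y : X.obj (F.obj T)) = x + y := by
  obtain ⟨R, p, q, w, rfl, rfl⟩ := exists_pair (F ⋙ X) (T := T) (S := T) x y
  refine (map_add_apply (X := F ⋙ X) p q w).symm.trans ?_
  change X.map (F.map (p + q)) w = _
  rw [Additive.map_add]
  exact map_add_apply _ _ _

end Burnside

section Kan

open Burnside

variable {B : Type (u + 1)} [Category.{u + 1} B] {D : Type (u + 1)} [Category.{u} D]
  [HasPullbacks D] [FinitaryExtensive D] (F : B ⥤ Burnside D) {X : B ⥤ Type (u + 1)}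

theorem lan_preservesFiniteProducts (hX : ProdPres X) : PreservesFiniteProducts (F.lan.obj X) :=
  ProdPres.preservesFiniteProducts
    ⟨fun S T => ⟨_, _, _, lan_preservesProd F hX (coprod_bijective S.as T.as)⟩,
      ⟨_, lan_preservesTerm F hX initial_unique⟩⟩

/-- The left Kan extension of a product preserving functor is group-valued as soon as each element
`x` of `X` is `X(p)(z)` for some `z` and `p` such that, for some `t`, the class of `X(t)(z)` is
zero and `F(t) = F(p) + r`. The negative of the class of `x` is then the image of the class of `z`
under `r`. No additivity of `F` is involved. -/
theorem lan_groupValued (hX : ProdPres X)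
    (h : ∀ (c : B) (x : X.obj c), ∃ (d : B) (z : X.obj d) (p t : d ⟶ c) (o : c ⟶ c)
      (r : F.obj d ⟶ F.obj c), X.map p z = x ∧ X.map t z = X.map o x ∧ F.map t = F.map p + r ∧
        F.map o = 0) : GroupValued (F.lan.obj X) := by
  have := lan_preservesFiniteProducts F hX
  refine .of_exists_add_eq_zero fun T y => ?_
  obtain ⟨c, f, x, rfl⟩ := exists_lanMk F y
  obtain ⟨d, z, p, t, o, r, hp, ht, hF, ho⟩ := h c x
  refine ⟨lanMk F X (r ≫ f) z, ?_⟩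
  have e : lanMk F X (F.map t ≫ f) z = 0 := by
    rw [← lanMk_map, ht, lanMk_map, ho, Burnside.zero_comp, lanMk, map_zero_apply]
  rw [← e, hF, add_comp, ← hp, lanMk_map]
  simp only [lanMk]
  rw [map_add_apply]

end Kan

end MackeyNorm

/-! ### Coinduction, products and transfers -/

namespace MackeyNorm

namespace Burnside

theorem isPullback_prodMap_fst {C : Type u} [Category.{v} C] [HasBinaryProducts C] {U V : C}
    (f : U ⟶ V) (W : C) :
    IsPullback (prod.map f (𝟙 W)) prod.fst prod.fst f := by
  refine ⟨⟨by simp⟩, ⟨PullbackCone.IsLimit.mk _ (fun s => prod.lift s.snd (s.fst ≫ prod.snd))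
    (fun s => ?_) (fun s => by simp [prod.lift_fst]) (fun s m h₁ h₂ => ?_)⟩⟩
  · ext
    · simp [prod.lift_fst, s.condition]
    · simp [prod.lift_snd]
  · ext
    · simp [prod.lift_fst, h₂]
    · simp [prod.lift_snd, ← h₁]

theorem isPullback_prodMap_snd {C : Type u} [Category.{v} C] [HasBinaryProducts C] {U V : C}
    (f : U ⟶ V) (W : C) :
    IsPullback (prod.map (𝟙 W) f) prod.snd prod.snd f := by
  refine ⟨⟨by simp⟩, ⟨PullbackCone.IsLimit.mk _ (fun s => prod.lift (s.fst ≫ prod.fst) s.snd)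
    (fun s => ?_) (fun s => by simp [prod.lift_snd]) (fun s m h₁ h₂ => ?_)⟩⟩
  · ext
    · simp [prod.lift_fst]
    · simp [prod.lift_snd, s.condition]
  · ext
    · simp [prod.lift_fst, ← h₁]
    · simp [prod.lift_snd, h₂]

variable {C : Type u} [Category.{v} C] [HasPullbacks C] [FinitaryExtensive C]

/-- The functor of Burnside categories induced by one that preserves binary coproducts is
additive. -/
theorem additive_map {D : Type*} [Category* D] [HasPullbacks D] [FinitaryExtensive D] (F : C ⥤ D)
    [PreservesLimitsOfShape WalkingCospan F]
    (h : ∀ U V : C, Nonempty (IsColimit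
      (BinaryCofan.mk (F.map (coprod.inl : U ⟶ U ⨿ V)) (F.map (coprod.inr : V ⟶ U ⨿ V))))) :
    Additive (map F) where
  map_add {S T} f g := by
    obtain ⟨S⟩ := S
    obtain ⟨T⟩ := T
    induction f using hom_ind with
    | h U l r =>
    induction g using hom_ind with
    | h V l' r' =>
      rw [span_add, map_span, map_span, map_span, span_eq_add (h U V).some]
      simp only [← F.map_comp, coprod.inl_desc, coprod.inr_desc]
      rfl

section Prod

variable [HasBinaryProducts C]

/-- Products distribute over coproducts: `prod.fst` exhibits `U ⨯ W` and `V ⨯ W` as the pullbacks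
of `U` and `V`, and coproducts are van Kampen. -/
theorem nonempty_isColimit_prodMap_left (U V W : C) : Nonempty (IsColimit (BinaryCofan.mk
    (prod.map (coprod.inl : U ⟶ U ⨿ V) (𝟙 W)) (prod.map coprod.inr (𝟙 W)))) :=
  ((BinaryCofan.isVanKampen_iff _).1 (FinitaryExtensive.vanKampen _ (coprodIsCoprod U V))
    (BinaryCofan.mk (prod.map coprod.inl (𝟙 W)) (prod.map coprod.inr (𝟙 W))) prod.fst prod.fst
    prod.fst (prod.map_fst _ _).symm (prod.map_fst _ _).symm).2
    ⟨isPullback_prodMap_fst _ W, isPullback_prodMap_fst _ W⟩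

theorem nonempty_isColimit_prodMap_right (U V W : C) : Nonempty (IsColimit (BinaryCofan.mk
    (prod.map (𝟙 W) (coprod.inl : U ⟶ U ⨿ V)) (prod.map (𝟙 W) coprod.inr))) :=
  ((BinaryCofan.isVanKampen_iff _).1 (FinitaryExtensive.vanKampen _ (coprodIsCoprod U V))
    (BinaryCofan.mk (prod.map (𝟙 W) coprod.inl) (prod.map (𝟙 W) coprod.inr)) prod.snd prod.snd
    prod.snd (prod.map_snd _ _).symm (prod.map_snd _ _).symm).2
    ⟨isPullback_prodMap_snd _ W, isPullback_prodMap_snd _ W⟩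

/-- The Cartesian product of morphisms of the Burnside category. This is the functor
`Burnside.prod` on morphisms, for objects that are given separately. -/
noncomputable def prodHom {S T S' T' : C} (f : Burnside.mk S ⟶ Burnside.mk T)
    (g : Burnside.mk S' ⟶ Burnside.mk T') : Burnside.mk (S ⨯ S') ⟶ Burnside.mk (T ⨯ T') :=
  (prod (C := C)).map (X := (⟨S⟩, ⟨S'⟩)) (Y := (⟨T⟩, ⟨T'⟩)) (f, g)

theorem prodHom_span {X Y U X' Y' U' : C} (l : U ⟶ X) (r : U ⟶ Y) (l' : U' ⟶ X') (r' : U' ⟶ Y') :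
    prodHom (span l r) (span l' r') = span (prod.map l l') (prod.map r r') := rfl

theorem prodHom_comp {R S T R' S' T' : C} (f : Burnside.mk R ⟶ Burnside.mk S)
    (g : Burnside.mk S ⟶ Burnside.mk T) (f' : Burnside.mk R' ⟶ Burnside.mk S')
    (g' : Burnside.mk S' ⟶ Burnside.mk T') :
    prodHom f f' ≫ prodHom g g' = prodHom (f ≫ g) (f' ≫ g') :=
  ((prod (C := C)).map_comp (X := (⟨R⟩, ⟨R'⟩)) (Y := (⟨S⟩, ⟨S'⟩)) (Z := (⟨T⟩, ⟨T'⟩))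
    (f, f') (g, g')).symm

theorem prodHom_id (S S' : C) : prodHom (𝟙 (Burnside.mk S)) (𝟙 (Burnside.mk S')) = 𝟙 _ :=
  (prod (C := C)).map_id (⟨S⟩, ⟨S'⟩)

theorem add_prodHom {S T S' T' : C} (f g : Burnside.mk S ⟶ Burnside.mk T)
    (h : Burnside.mk S' ⟶ Burnside.mk T') : prodHom (f + g) h = prodHom f h + prodHom g h := by
  induction f using hom_ind with
  | h U l r =>
  induction g using hom_ind with
  | h V l' r' =>
  induction h using hom_ind with
  | h W m n =>
    rw [span_add, prodHom_span, prodHom_span, prodHom_span,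
      span_eq_add (nonempty_isColimit_prodMap_left U V W).some]
    simp only [prod.map_map, coprod.inl_desc, coprod.inr_desc, Category.id_comp]

theorem prodHom_add {S T S' T' : C} (h : Burnside.mk S' ⟶ Burnside.mk T')
    (f g : Burnside.mk S ⟶ Burnside.mk T) : prodHom h (f + g) = prodHom h f + prodHom h g := by
  induction f using hom_ind with
  | h U l r =>
  induction g using hom_ind with
  | h V l' r' =>
  induction h using hom_ind with
  | h W m n =>
    rw [span_add, prodHom_span, prodHom_span, prodHom_span,
      span_eq_add (nonempty_isColimit_prodMap_right U V W).some]
    simp only [prod.map_map, coprod.inl_desc, coprod.inr_desc, Category.id_comp]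

theorem zero_prodHom {S T S' T' : C} (h : Burnside.mk S' ⟶ Burnside.mk T') :
    prodHom (0 : Burnside.mk S ⟶ Burnside.mk T) h = 0 := by
  induction h using hom_ind with
  | h W m n =>
    rw [zero_eq_span, prodHom_span]
    have : IsIso (prod.fst : (⊥_ C) ⨯ W ⟶ _) := initialIsInitial.isIso_to _
    exact span_eq_zero (initialIsInitial.ofIso (asIso (prod.fst : (⊥_ C) ⨯ W ⟶ _)).symm) _ _

theorem prodHom_zero {S T S' T' : C} (h : Burnside.mk S' ⟶ Burnside.mk T') :
    prodHom h (0 : Burnside.mk S ⟶ Burnside.mk T) = 0 := by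
  induction h using hom_ind with
  | h W m n =>
    rw [zero_eq_span, prodHom_span]
    have : IsIso (prod.snd : W ⨯ (⊥_ C) ⟶ _) := initialIsInitial.isIso_to _
    exact span_eq_zero (initialIsInitial.ofIso (asIso (prod.snd : W ⨯ (⊥_ C) ⟶ _)).symm) _ _

end Prod

end Burnside

section GSets

variable {G : Type u} [Group G]

/-- Coproducts of finite `G`-sets are recognized on underlying sets. -/
theorem nonempty_isColimit_binaryCofan_iff {U V W : FinGSet G} (i : U ⟶ W) (j : V ⟶ W) :
    Nonempty (IsColimit (BinaryCofan.mk i j)) ↔ Function.Injective i.hom ∧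
      Function.Injective j.hom ∧ IsCompl (Set.range i.hom) (Set.range j.hom) := by
  let Φ := Action.forget FintypeCat.{u} G ⋙ FintypeCat.incl
  refine Iff.trans ⟨fun ⟨h⟩ => ?_, fun ⟨h⟩ => ?_⟩
    (Types.binaryCofan_isColimit_iff (BinaryCofan.mk (Φ.map i) (Φ.map j)))
  · exact ⟨isColimitMapCoconeBinaryCofanEquiv Φ i j (isColimitOfPreserves Φ h)⟩
  · exact ⟨isColimitOfReflects Φ ((isColimitMapCoconeBinaryCofanEquiv Φ i j).symm h)⟩

theorem act_mul (W : FinGSet G) (g h : G) (w : W.V) : act W (g * h) w = act W g (act W h w) :=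
  ConcreteCategory.congr_hom (map_mul W.ρ g h) w

theorem act_one (W : FinGSet G) (w : W.V) : act W 1 w = w :=
  ConcreteCategory.congr_hom (map_one W.ρ) w

theorem act_inv_act (W : FinGSet G) (g : G) (w : W.V) : act W g⁻¹ (act W g w) = w := by
  rw [← act_mul, inv_mul_cancel, act_one]

theorem act_act_inv (W : FinGSet G) (g : G) (w : W.V) : act W g (act W g⁻¹ w) = w := by
  rw [← act_mul, mul_inv_cancel, act_one]

theorem hom_act {U W : FinGSet G} (f : U ⟶ W) (g : G) (u : U.V) :
    f.hom (act U g u) = act W g (f.hom u) :=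
  ConcreteCategory.congr_hom (f.comm g) u

/-- The sub-`G`-set on a stable subset. -/
def subGSet (W : FinGSet G) (p : Set W.V) (hp : ∀ g, ∀ w ∈ p, act W g w ∈ p) : FinGSet G where
  V := FintypeCat.of p
  ρ :=
    { toFun g := FintypeCat.homMk fun w => ⟨act W g w.1, hp g w.1 w.2⟩
      map_one' := FintypeCat.hom_ext _ _ fun w => Subtype.ext (act_one W w.1)
      map_mul' a b := FintypeCat.hom_ext _ _ fun w => Subtype.ext (act_mul W a b w.1) }

/-- The inclusion of a stable subset. -/
def subGSetι (W : FinGSet G) (p : Set W.V) (hp : ∀ g, ∀ w ∈ p, act W g w ∈ p) :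
    subGSet W p hp ⟶ W where
  hom := FintypeCat.homMk fun w => w.1
  comm _ := rfl

theorem range_subGSetι (W : FinGSet G) (p : Set W.V) (hp : ∀ g, ∀ w ∈ p, act W g w ∈ p) :
    Set.range (subGSetι W p hp).hom = p :=
  Subtype.range_coe

/-- An injection of finite `G`-sets is the inclusion of a summand. -/
theorem exists_compl {U W : FinGSet G} (i : U ⟶ W) (hi : Function.Injective i.hom) :
    ∃ (V : FinGSet G) (j : V ⟶ W), Nonempty (IsColimit (BinaryCofan.mk i j)) := by
  have hp : ∀ g, ∀ w ∈ (Set.range i.hom)ᶜ, act W g w ∈ (Set.range i.hom)ᶜ := by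
    rintro g w hw ⟨u, hu⟩
    exact hw ⟨act U g⁻¹ u, by rw [hom_act, hu, act_inv_act]⟩
  refine ⟨subGSet W _ hp, subGSetι W _ hp, (nonempty_isColimit_binaryCofan_iff _ _).2
    ⟨hi, Subtype.val_injective, ?_⟩⟩
  rw [range_subGSetι]
  exact isCompl_compl

/-- The empty `G`-set. -/
def emptyGSet (G : Type u) [Group G] : FinGSet G where
  V := FintypeCat.of PEmpty
  ρ := 1

/-- A `G`-set without elements is initial. -/
def isInitialOfIsEmpty (W : FinGSet G) [IsEmpty W.V] : IsInitial W :=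
  IsInitial.ofUniqueHom
    (fun _ =>
      { hom := FintypeCat.homMk fun w => isEmptyElim (α := W.V) w
        comm _ := FintypeCat.hom_ext _ _ fun w => isEmptyElim (α := W.V) w })
    (fun _ _ => Action.hom_ext _ _ (FintypeCat.hom_ext _ _ fun w => isEmptyElim (α := W.V) w))

theorem isEmpty_of_isInitial {W : FinGSet G} (h : IsInitial W) : IsEmpty W.V :=
  ⟨fun w => PEmpty.elim ((h.to (emptyGSet G)).hom w)⟩

theorem nonempty_isColimit_fixedPts (N : Subgroup G) [N.Normal] {U V W : FinGSet G} {i : U ⟶ W}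
    {j : V ⟶ W} (h : Nonempty (IsColimit (BinaryCofan.mk i j))) :
    Nonempty (IsColimit (BinaryCofan.mk ((fixedPts N).map i) ((fixedPts N).map j))) := by
  rw [nonempty_isColimit_binaryCofan_iff] at h ⊢
  obtain ⟨hi, hj, hij⟩ := h
  -- a preimage of a fixed point under an injection is fixed
  have key {U : FinGSet G} {i : U ⟶ W} (hi : Function.Injective i.hom)
      (w : ((fixedPts N).obj W).V) :
      w ∈ Set.range ((fixedPts N).map i).hom ↔ w.1 ∈ Set.range i.hom := by
    constructor
    · rintro ⟨u, rfl⟩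
      exact ⟨u.1, rfl⟩
    · rintro ⟨u, hu⟩
      refine ⟨⟨u, fun n hn => hi ?_⟩, Subtype.ext hu⟩
      rw [hom_act, hu]
      exact w.2 n hn
  refine ⟨fun a b hab => Subtype.ext (hi (congrArg Subtype.val hab)),
    fun a b hab => Subtype.ext (hj (congrArg Subtype.val hab)), ?_⟩
  rw [← compl_eq_iff_isCompl] at hij ⊢
  ext w
  rw [Set.mem_compl_iff, key hi, key hj, ← hij, Set.mem_compl_iff]

instance (N : Subgroup G) [N.Normal] : Burnside.Additive (Burnside.map (fixedPts N)) :=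
  Burnside.additive_map _ fun U V => nonempty_isColimit_fixedPts N ⟨coprodIsCoprod U V⟩

instance {H : Type u} [Group H] (f : G →* H) :
    Burnside.Additive (Burnside.map (Action.res FintypeCat.{u} f)) :=
  Burnside.additive_map _ fun U V => (nonempty_isColimit_binaryCofan_iff _ _).2
    ((nonempty_isColimit_binaryCofan_iff (coprod.inl : U ⟶ U ⨿ V) coprod.inr).1
      ⟨coprodIsCoprod U V⟩)

section Coind

variable [Finite G] (H : Subgroup G)

theorem coind_map_zero (S T : FinGSet H) :
    (Burnside.map (coind H)).map (0 : Burnside.mk S ⟶ Burnside.mk T) = 0 := by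
  have : IsEmpty ((coind H).obj (⊥_ FinGSet H)).V :=
    ⟨fun f => (isEmpty_of_isInitial (initialIsInitial (C := FinGSet H))).elim (f.1 1)⟩
  exact Burnside.span_eq_zero (isInitialOfIsEmpty _) _ _

/-- The transfer along the fold map, coinduced, exceeds the coinduced restriction to a summand by
an honest span: the one on the functions `G → S ⨿ S` that leave the first summand. -/
theorem exists_coind_map_tr_codiag (S : FinGSet H) :
    ∃ r : (Burnside.map (coind H)).obj ⟨S ⨿ S⟩ ⟶ (Burnside.map (coind H)).obj ⟨S⟩,
      (Burnside.map (coind H)).map (Burnside.tr (coprod.desc (𝟙 S) (𝟙 S))) =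
        (Burnside.map (coind H)).map (Burnside.res coprod.inl) + r := by
  have hi : Function.Injective ((coind H).map (coprod.inl : S ⟶ S ⨿ S)).hom := by
    intro a b hab
    have h := ((nonempty_isColimit_binaryCofan_iff _ _).1 ⟨coprodIsCoprod S S⟩).1
    exact Subtype.ext (funext fun g => h (congrFun (congrArg Subtype.val hab) g))
  obtain ⟨V, j, ⟨hj⟩⟩ := exists_compl _ hi
  refine ⟨Burnside.span j (j ≫ (coind H).map (coprod.desc (𝟙 S) (𝟙 S))), ?_⟩
  rw [Burnside.tr, Burnside.map_span, Burnside.span_eq_add hj, Burnside.res, Burnside.map_span]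
  simp only [← Functor.map_comp, coprod.inl_desc, Category.comp_id]
  rfl

end Coind

end GSets

end MackeyNorm

/-! ### Mackey functors are preserved by the constructions -/

namespace MackeyNorm

open Burnside

variable {G : Type u} [Group G]

theorem isMackey_iff_groupValued (M : SetFunctor G) : IsMackey M ↔ GroupValued M :=
  ⟨fun h => ⟨h.1, h.2⟩, fun h => ⟨h.1, h.2⟩⟩

theorem IsMackey.groupValued {M : SetFunctor G} (h : IsMackey M) : GroupValued M :=
  (isMackey_iff_groupValued M).1 h

section Orbits

variable [Finite G]

/-- The map from `G/J` to a `G`-set that corresponds to an element stabilized by `J`. -/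
def orbitMap (W : FinGSet G) (w : W.V) (J : Subgroup G) (hJ : ∀ g ∈ J, act W g w = w) :
    orbit J ⟶ W where
  hom := FintypeCat.homMk (X := FintypeCat.of (G ⧸ J)) <|
    Quotient.lift (fun g => act W g w) fun a b hab => by
      have h := hJ _ (QuotientGroup.leftRel_apply.1 hab)
      rw [act_mul] at h
      change act W a w = act W b w
      rw [← act_act_inv W a (act W b w), h]
  comm g := FintypeCat.hom_ext _ _ fun x => by
    induction x using QuotientGroup.induction_on with
    | H x => exact act_mul W g x w

theorem isEmpty_fixedPts_orbit {N : Subgroup G} [N.Normal] {J : Subgroup G} (h : ¬ N ≤ J) :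
    IsEmpty ((fixedPts N).obj (orbit J)).V := by
  refine ⟨fun ⟨x, hx⟩ => h fun n hn => ?_⟩
  obtain ⟨g, rfl⟩ := QuotientGroup.mk_surjective (s := J) x
  have := hx (g * n * g⁻¹) (Subgroup.Normal.conj_mem ‹_› n hn g)
  have := QuotientGroup.eq.1 (show QuotientGroup.mk (s := J) (g * n * g⁻¹ * g) =
    QuotientGroup.mk g from this).symm
  simpa [mul_assoc] using this

theorem isEmpty_fixedPts_of_hom {N : Subgroup G} [N.Normal] {U V : FinGSet G} (f : U ⟶ V)
    (h : IsEmpty ((fixedPts N).obj V).V) : IsEmpty ((fixedPts N).obj U).V :=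
  ⟨fun u => h.elim (((fixedPts N).map f).hom u)⟩

/-- A span whose apex has no `N`-fixed points lies in `EF_N(A)`. By induction on the size of the
apex `V`: split off an orbit `G/J`, where `N` is not contained in the stabilizer `J`. The summand
with apex `G/J` is the transfer of an element of `A(G/J)`. -/
theorem of_span_mem_subEF {N : Subgroup G} [N.Normal] (n : ℕ) {V T : FinGSet G}
    (hn : Nat.card V.V = n) (hV : IsEmpty ((fixedPts N).obj V).V) (l : V ⟶ ⊤_ (FinGSet G))
    (r : V ⟶ T) : Algebra.GrothendieckAddGroup.of (Burnside.span l r) ∈ subEF N ⟨T⟩ := by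
  induction n using Nat.strong_induction_on generalizing V with
  | h n ih =>
  by_cases hVe : IsEmpty V.V
  · rw [span_eq_zero (isInitialOfIsEmpty V), map_zero]
    exact zero_mem _
  · rw [not_isEmpty_iff] at hVe
    obtain ⟨v⟩ := hVe
    let J : Subgroup G :=
      { carrier := {g | act V g v = v}
        mul_mem' {a b} ha hb := by
          change act V (a * b) v = v
          rw [act_mul, show act V b v = v from hb, show act V a v = v from ha]
        one_mem' := act_one V v
        inv_mem' {a} ha := by
          change act V a⁻¹ v = v
          conv_lhs => rw [← show act V a v = v from ha]
          exact act_inv_act V a v }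
    have hJ : ¬ N ≤ J := fun h => hV.elim ⟨v, fun n hn => h hn⟩
    let i : orbit J ⟶ V := orbitMap V v J fun g hg => hg
    have hi : Function.Injective i.hom := by
      intro a b hab
      obtain ⟨a, rfl⟩ := QuotientGroup.mk_surjective (s := J) a
      obtain ⟨b, rfl⟩ := QuotientGroup.mk_surjective (s := J) b
      refine QuotientGroup.eq.2 ?_
      change act V (a⁻¹ * b) v = v
      rw [act_mul, ← show act V a v = act V b v from hab, act_inv_act]
    obtain ⟨V', j, hij⟩ := exists_compl i hi
    have hij' := (nonempty_isColimit_binaryCofan_iff _ _).1 hij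
    rw [span_eq_add hij.some, map_add]
    refine add_mem (AddSubgroup.subset_closure ?_) ?_
    · refine ⟨J, hJ, tr (i ≫ r), Algebra.GrothendieckAddGroup.of (res (i ≫ l)), ?_⟩
      rw [BurnsideGroup.map_of, res_comp_tr]
    · refine ih _ ?_ rfl (isEmpty_fixedPts_of_hom j hV) _ _
      rw [← hn]
      refine lt_of_le_of_ne (Nat.card_le_card_of_injective _ hij'.2.1) fun hc => ?_
      have hs := ((Nat.bijective_iff_injective_and_card j.hom).2 ⟨hij'.2.1, hc⟩).2 v
      exact hij'.2.2.disjoint.le_bot ⟨⟨QuotientGroup.mk (s := J) 1, act_one V v⟩, hs⟩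

end Orbits

theorem BurnsideGroup.map_add {S T : BurnsideCat G} (f g : S ⟶ T) :
    BurnsideGroup.map (f + g) = BurnsideGroup.map f + BurnsideGroup.map g := by
  refine BurnsideGroup.hom_ext fun a => ?_
  rw [AddMonoidHom.add_apply, BurnsideGroup.map_of, BurnsideGroup.map_of, BurnsideGroup.map_of,
    comp_add, _root_.map_add]

theorem BurnsideGroup.map_zero (S T : BurnsideCat G) :
    BurnsideGroup.map (0 : S ⟶ T) = 0 := by
  refine BurnsideGroup.hom_ext fun a => ?_
  rw [BurnsideGroup.map_of, Burnside.comp_zero, _root_.map_zero]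
  rfl

variable [Finite G]

instance tildeEFA_groupValued (N : Subgroup G) : GroupValued (tildeEFA N) := by
  let (T : BurnsideCat G) : AddCommGroup ((tildeEFA N).obj T) :=
    QuotientAddGroup.Quotient.addCommGroup (subEF N T)
  refine GroupValued.of_additive (fun f x y => map_add (QuotientAddGroup.map _ _
    (BurnsideGroup.map f) (subEF_le_comap N f)) x y) (fun f g x => ?_)
  induction x using QuotientAddGroup.induction_on with
  | H x => exact congrArg _ (DFunLike.congr_fun (BurnsideGroup.map_add f g) x)

/-- The norm of a Mackey functor is a Mackey functor. For `x ∈ M(S)` and the element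
`(x, -x) ∈ M(S ⨿ S)`, the coinduced fold map sends `(x, -x)` to zero and splits off the coinduced
restriction to the first summand, which sends `(x, -x)` to `x`. -/
instance normFunctor_groupValued (H : Subgroup G) (X : SetFunctor H) [GroupValued X] :
    GroupValued ((normFunctor H).obj X) := by
  refine lan_groupValued _ (prodPres_of_preservesFiniteProducts X) fun S x => ?_
  obtain ⟨z, hz, hz'⟩ := GroupValued.exists_neg S.as x
  obtain ⟨r, hr⟩ := exists_coind_map_tr_codiag H S.as
  exact ⟨_, z, res coprod.inl, tr (coprod.desc (𝟙 _) (𝟙 _)), 0, r, hz, hz', hr,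
    coind_map_zero H _ _⟩

/-- If `A` is the product of `B₁` and `B₂`, and `A'` that of `B₁'` and `B₂'`, then `A × A'` is the
product of `B₁ × B₁'` and `B₂ × B₂'`. -/
theorem bijective_prod_pairs {A A' B₁ B₂ B₁' B₂' : Type*} {f₁ : A → B₁} {f₂ : A → B₂}
    {g₁ : A' → B₁'} {g₂ : A' → B₂'} (hf : Function.Bijective fun a => (f₁ a, f₂ a))
    (hg : Function.Bijective fun a => (g₁ a, g₂ a)) :
    Function.Bijective fun a : A × A' => ((f₁ a.1, g₁ a.2), (f₂ a.1, g₂ a.2)) :=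
  (Equiv.prodProdProdComm B₁ B₂ B₁' B₂').bijective.comp (hf.prodMap hg)

theorem externalProduct_prodPres (X Y : SetFunctor G) [PreservesFiniteProducts X]
    [PreservesFiniteProducts Y] : ProdPres ((MonoidalCategory.externalProductBifunctor
      (BurnsideCat G) (BurnsideCat G) (Type (u + 1))).obj (X, Y)) where
  prod S T := by
    obtain ⟨⟨S⟩, ⟨S'⟩⟩ := S
    obtain ⟨⟨T⟩, ⟨T'⟩⟩ := T
    refine ⟨(⟨S ⨿ T⟩, ⟨S' ⨿ T'⟩), (res coprod.inl, res coprod.inl),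
      (res coprod.inr, res coprod.inr), ⟨fun d => ?_, ?_⟩⟩
    · exact bijective_prod_pairs (coprod_bijective S T d.1) (coprod_bijective S' T' d.2)
    · exact bijective_prod_pairs
        (bijective_of_preservesFiniteProducts (X := X) (coprod_bijective S T))
        (bijective_of_preservesFiniteProducts (X := Y) (coprod_bijective S' T'))
  term := by
    refine ⟨(⟨⊥_ _⟩, ⟨⊥_ _⟩), fun d => ?_, ?_⟩
    · obtain ⟨i⟩ := initial_unique d.1
      obtain ⟨j⟩ := initial_unique d.2
      exact ⟨⟨⟨(0, 0)⟩, fun a => Prod.ext (i.instSubsingleton.elim _ _)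
        (j.instSubsingleton.elim _ _)⟩⟩
    · obtain ⟨i⟩ := nonempty_unique_of_preservesFiniteProducts (X := X) initial_unique
      obtain ⟨j⟩ := nonempty_unique_of_preservesFiniteProducts (X := Y) initial_unique
      exact ⟨⟨⟨(i.default, j.default)⟩, fun a => Prod.ext (i.instSubsingleton.elim _ _)
        (j.instSubsingleton.elim _ _)⟩⟩

/-- The box product of Mackey functors is a Mackey functor. The product with `S'` takes the
transfer along the fold map of `S` to the sum of the two restrictions. -/
instance box_groupValued (X Y : SetFunctor G) [GroupValued X] [PreservesFiniteProducts Y] :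
    GroupValued ((box G).obj (X, Y)) := by
  refine lan_groupValued _ (externalProduct_prodPres X Y) fun S x => ?_
  obtain ⟨⟨S⟩, ⟨S'⟩⟩ := S
  obtain ⟨x, y⟩ := x
  obtain ⟨z, hz, hz'⟩ := GroupValued.exists_neg S x
  refine ⟨(⟨S ⨿ S⟩, ⟨S'⟩), (z, y), (res coprod.inl, 𝟙 _),
    (tr (coprod.desc (𝟙 _) (𝟙 _)), 𝟙 _), (0, 𝟙 _), prodHom (res coprod.inr) (𝟙 _), ?_, ?_, ?_, ?_⟩
  · exact Prod.ext hz (by exact Functor.map_id_apply Y _ y)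
  · exact Prod.ext hz' rfl
  · change prodHom (tr (coprod.desc (𝟙 S) (𝟙 S))) (𝟙 (Burnside.mk S')) =
      prodHom (res coprod.inl) (𝟙 _) + prodHom (res coprod.inr) (𝟙 _)
    rw [tr_codiag, add_prodHom]
    rfl
  · exact zero_prodHom _

instance (N : Subgroup G) [N.Normal] (X : SetFunctor G) [GroupValued X] :
    GroupValued ((geomFixedPts N).obj X) :=
  inferInstanceAs (GroupValued (Burnside.map (infl N) ⋙ (box G).obj (X, tildeEFA N)))

end MackeyNorm

/-! ### The box product with the quotient of the Burnside functor -/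

namespace MackeyNorm

open Burnside

variable {G : Type u} [Group G]

section Box

variable (X Y : SetFunctor G)

/-- The functor `(S, T) ↦ X(S) × Y(T)`. -/
noncomputable abbrev extProd : BurnsideCat G × BurnsideCat G ⥤ Type (u + 1) :=
  (MonoidalCategory.externalProductBifunctor (BurnsideCat G) (BurnsideCat G)
    (Type (u + 1))).obj (X, Y)

variable {X Y}

/-- The element of `(X □ Y)(S × S')` given by `x ∈ X(S)` and `y ∈ Y(S')`. -/
noncomputable def boxMk {S S' : FinGSet G} (x : X.obj ⟨S⟩) (y : Y.obj ⟨S'⟩) :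
    ((box G).obj (X, Y)).obj ⟨S ⨯ S'⟩ :=
  (Burnside.prod.lanUnit.app (extProd X Y)).app (⟨S⟩, ⟨S'⟩) (x, y)

theorem map_prodHom_boxMk {S S' T T' : FinGSet G} (f : Burnside.mk S ⟶ Burnside.mk T)
    (g : Burnside.mk S' ⟶ Burnside.mk T') (x : X.obj ⟨S⟩) (y : Y.obj ⟨S'⟩) :
    ((box G).obj (X, Y)).map (prodHom f g) (boxMk x y) = boxMk (X.map f x) (Y.map g y) := by
  let xy : (extProd X Y).obj (⟨S⟩, ⟨S'⟩) := (x, y)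
  have h := (Burnside.prod.lanUnit.app (extProd X Y)).naturality
    (X := (⟨S⟩, ⟨S'⟩)) (Y := (⟨T⟩, ⟨T'⟩)) (f, g)
  exact (ConcreteCategory.congr_hom h xy).symm

theorem exists_boxMk {T : BurnsideCat G} (z : ((box G).obj (X, Y)).obj T) :
    ∃ (S S' : FinGSet G) (f : Burnside.mk (S ⨯ S') ⟶ T) (x : X.obj ⟨S⟩) (y : Y.obj ⟨S'⟩),
      ((box G).obj (X, Y)).map f (boxMk x y) = z := by
  obtain ⟨⟨S, S'⟩, f, x, rfl⟩ := exists_lanMk (Burnside.prod (C := FinGSet G))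
    (X := extProd X Y) z
  exact ⟨S.as, S'.as, f, x.1, x.2, rfl⟩

/-- The universal property of the box product: maps `X(S) × Y(S') → Z(S × S')`, natural in `S` and
`S'`, induce a map `X □ Y → Z`. -/
theorem exists_boxDesc {Z : SetFunctor G}
    (ψ : ∀ S S' : FinGSet G, X.obj ⟨S⟩ → Y.obj ⟨S'⟩ → Z.obj ⟨S ⨯ S'⟩)
    (hψ : ∀ (S S' T T' : FinGSet G) (f : Burnside.mk S ⟶ Burnside.mk T)
      (g : Burnside.mk S' ⟶ Burnside.mk T') (x : X.obj ⟨S⟩) (y : Y.obj ⟨S'⟩),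
      ψ T T' (X.map f x) (Y.map g y) = Z.map (prodHom f g) (ψ S S' x y)) :
    ∃ β : (box G).obj (X, Y) ⟶ Z, ∀ (S S' : FinGSet G) (x : X.obj ⟨S⟩) (y : Y.obj ⟨S'⟩),
      β.app _ (boxMk x y) = ψ S S' x y := by
  let τ : extProd X Y ⟶ Burnside.prod ⋙ Z :=
    { app := fun S => ↾(fun xy => ψ S.1.as S.2.as xy.1 xy.2)
      naturality := fun S T f => by
        ext xy
        exact hψ S.1.as S.2.as T.1.as T.2.as f.1 f.2 xy.1 xy.2 }
  refine ⟨Functor.descOfIsLeftKanExtension _ (Burnside.prod.lanUnit.app (extProd X Y)) Z τ,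
    fun S S' x y => ?_⟩
  let xy : (extProd X Y).obj (⟨S⟩, ⟨S'⟩) := (x, y)
  have h := Functor.descOfIsLeftKanExtension_fac_app _
    (Burnside.prod.lanUnit.app (extProd X Y)) Z τ (⟨S⟩, ⟨S'⟩)
  exact ConcreteCategory.congr_hom h xy

theorem box_map_boxMk {X' Y' : SetFunctor G} (φ : X ⟶ X') (χ : Y ⟶ Y') {S S' : FinGSet G}
    (x : X.obj ⟨S⟩) (y : Y.obj ⟨S'⟩) :
    ((box G).map (X := (X, Y)) (Y := (X', Y')) (φ, χ)).app _ (boxMk x y) =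
      boxMk (φ.app _ x) (χ.app _ y) := by
  let xy : (extProd X Y).obj (⟨S⟩, ⟨S'⟩) := (x, y)
  have h := NatTrans.congr_app (Burnside.prod.lanUnit.naturality
    ((MonoidalCategory.externalProductBifunctor (BurnsideCat G) (BurnsideCat G)
      (Type (u + 1))).map (X := (X, Y)) (Y := (X', Y')) (φ, χ))) (⟨S⟩, ⟨S'⟩)
  exact (ConcreteCategory.congr_hom h xy).symm

end Box

section Spans

variable {C : Type u} [Category.{v} C] [HasPullbacks C] [FinitaryExtensive C]
  [HasBinaryProducts C]

theorem prodHom_id_comp_tr_fst {S T : C} (f : Burnside.mk S ⟶ Burnside.mk T) (W : C) :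
    prodHom f (𝟙 (Burnside.mk W)) ≫ tr prod.fst = tr prod.fst ≫ f := by
  induction f using hom_ind with
  | h V l r =>
    rw [id_eq_span, prodHom_span, span_comp_tr]
    refine Eq.trans ?_ (span_comp (isPullback_prodMap_fst l W)).symm
    simp

theorem comp_res_fst {S T : C} (f : Burnside.mk S ⟶ Burnside.mk T) (W : C) :
    f ≫ res (prod.fst : T ⨯ W ⟶ T) = res prod.fst ≫ prodHom f (𝟙 (Burnside.mk W)) := by
  induction f using hom_ind with
  | h V l r =>
    rw [id_eq_span, prodHom_span, res_comp_span]
    refine (span_comp (isPullback_prodMap_fst r W).flip).trans ?_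
    simp

theorem tr_eq_res {S T : C} (e : S ≅ T) : tr e.hom = res e.inv :=
  span_eq e (by simp) (by simp)

variable [HasTerminal C]

/-- The isomorphism `S × * ≅ S`. -/
noncomputable def prodTerminalIso (S : C) : S ⨯ (⊤_ C) ≅ S where
  hom := prod.fst
  inv := prod.lift (𝟙 S) (terminal.from S)
  hom_inv_id := by ext; all_goals simp [prod.lift_fst]
  inv_hom_id := by simp [prod.lift_fst]

theorem tr_fst_comp_res_fst (S : C) :
    tr (prod.fst : S ⨯ (⊤_ C) ⟶ S) ≫ res prod.fst = 𝟙 _ := by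
  have : Mono (prod.fst : S ⨯ (⊤_ C) ⟶ S) :=
    inferInstanceAs (Mono (prodTerminalIso S).hom)
  exact tr_comp_res_of_mono _

theorem res_fst_comp_tr_fst (S : C) :
    res (prod.fst : S ⨯ (⊤_ C) ⟶ S) ≫ tr prod.fst = 𝟙 _ := by
  rw [res_comp_tr, id_eq_span]
  exact span_eq (prodTerminalIso S) (Category.comp_id _) (Category.comp_id _)

/-- The projection `S × * ≅ S` factors through `S × S`. -/
theorem tr_fst_eq (S : C) : tr (prod.fst : S ⨯ (⊤_ C) ⟶ S) =
    prodHom (𝟙 (Burnside.mk S)) (res (terminal.from S)) ≫ res (diag S) := by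
  refine (tr_eq_res (prodTerminalIso S)).trans ?_
  rw [id_eq_span]
  change _ = prodHom (Burnside.span _ _) (Burnside.span _ _) ≫ _
  rw [prodHom_span]
  have : Burnside.span (prod.map (𝟙 S) (terminal.from S)) (prod.map (𝟙 S) (𝟙 S)) =
      res (prod.map (𝟙 S) (terminal.from S)) := by
    rw [prod.map_id_id, res]
  rw [this, res_comp_res]
  congr 1
  ext
  all_goals simp [prodTerminalIso, prod.lift_fst]

/-- The morphism `S → S × T` given by `u : * → T`. -/
noncomputable def insertHom (S : C) {T : C} (u : Burnside.mk (⊤_ C) ⟶ Burnside.mk T) :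
    Burnside.mk S ⟶ Burnside.mk (S ⨯ T) :=
  res prod.fst ≫ prodHom (𝟙 (Burnside.mk S)) u

theorem insertHom_comp {S S' T T' : C} (u : Burnside.mk (⊤_ C) ⟶ Burnside.mk T)
    (f : Burnside.mk S ⟶ Burnside.mk S') (g : Burnside.mk T ⟶ Burnside.mk T') :
    insertHom S u ≫ prodHom f g = f ≫ insertHom S' (u ≫ g) := by
  rw [insertHom, insertHom, Category.assoc, prodHom_comp, Category.id_comp, ← Category.assoc f,
    comp_res_fst, Category.assoc, prodHom_comp, Category.id_comp, Category.comp_id]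

theorem insertHom_add (S : C) {T : C}
    (u v : Burnside.mk (⊤_ C) ⟶ Burnside.mk T) :
    insertHom S (u + v) = insertHom S u + insertHom S v := by
  rw [insertHom, prodHom_add, comp_add]
  rfl

end Spans

section TildeEF

variable [Finite G] (N : Subgroup G)

/-- The class in `(A / EF_N(A))(T)` of an element of `A(T)`. -/
noncomputable def tildeMk {T : BurnsideCat G} (x : BurnsideGroup T) : (tildeEFA N).obj T :=
  (QuotientAddGroup.mk x : BurnsideGroup T ⧸ subEF N T)

theorem map_tildeMk {S T : BurnsideCat G} (f : S ⟶ T) (x : BurnsideGroup S) :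
    (tildeEFA N).map f (tildeMk N x) = tildeMk N (BurnsideGroup.map f x) := rfl

theorem exists_tildeMk {T : BurnsideCat G} (y : (tildeEFA N).obj T) : ∃ x, tildeMk N x = y :=
  QuotientAddGroup.mk_surjective (s := subEF N T) y

theorem tildeMk_eq_of_mem {T : BurnsideCat G} {x : BurnsideGroup T} (h : x ∈ subEF N T) :
    tildeMk N x = tildeMk N 0 :=
  (QuotientAddGroup.eq_zero_iff (N := subEF N T) x).2 h

/-- The functor `ẼF_N(M) = M □ A / EF_N(A)`. -/
noncomputable abbrev tildeBox (M : SetFunctor G) : SetFunctor G := (box G).obj (M, tildeEFA N)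

/-- The unit of the ring `(A / EF_N(A))(*)`. -/
noncomputable def tildeOne : (tildeEFA N).obj ⟨⊤_ (FinGSet G)⟩ :=
  tildeMk N (Algebra.GrothendieckAddGroup.of (𝟙 _))

theorem map_tildeOne {T : FinGSet G} (u : Burnside.mk (⊤_ (FinGSet G)) ⟶ Burnside.mk T) :
    (tildeEFA N).map u (tildeOne N) = tildeMk N (Algebra.GrothendieckAddGroup.of u) := by
  rw [tildeOne, map_tildeMk, BurnsideGroup.map_of, Category.id_comp]

variable (M : SetFunctor G)

/-- The natural map `M ≅ M □ A → M □ A / EF_N(A)`. -/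
noncomputable def tildeUnit : M ⟶ tildeBox N M where
  app S := ↾(fun m => (tildeBox N M).map (tr prod.fst)
    (boxMk (S := S.as) (S' := ⊤_ _) m (tildeOne N)))
  naturality S T f := by
    ext m
    change (tildeBox N M).map _ (boxMk (M.map f m) _) =
      (tildeBox N M).map f ((tildeBox N M).map _ _)
    have h := map_prodHom_boxMk (S := S.as) (T := T.as) f (𝟙 _) m (tildeOne N)
    rw [Functor.map_id_apply (tildeEFA N)] at h
    rw [← h, ← Functor.map_comp_apply, ← Functor.map_comp_apply, prodHom_id_comp_tr_fst]

variable {M}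

theorem tildeUnit_app {S : FinGSet G} (m : M.obj ⟨S⟩) : (tildeUnit N M).app ⟨S⟩ m =
    (tildeBox N M).map (tr prod.fst) (boxMk m (tildeOne N)) := rfl

/-- The element of the box product given by `m ∈ M(S)` and a span `u : * → T` comes from the image
of `m` under `tildeUnit`. So `M □ A/EF_N(A)` is generated by the image of `M`. -/
theorem boxMk_tildeMk_of {S T : FinGSet G} (m : M.obj ⟨S⟩)
    (u : Burnside.mk (⊤_ (FinGSet G)) ⟶ Burnside.mk T) :
    boxMk m (tildeMk N (Algebra.GrothendieckAddGroup.of u)) =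
      (tildeBox N M).map (insertHom S u) ((tildeUnit N M).app ⟨S⟩ m) := by
  have h := map_prodHom_boxMk (𝟙 _) u m (tildeOne N)
  rw [Functor.map_id_apply M, map_tildeOne] at h
  rw [← h, tildeUnit_app, ← Functor.map_comp_apply, insertHom, ← Category.assoc,
    tr_fst_comp_res_fst, Category.id_comp]

variable [GroupValued M]

/-- The map `M(S) × A(T) → (M □ A / EF_N(A))(S × T)` as a homomorphism in the second variable. To
see that it is additive, represent `(x, y)` by an element `w` of `A(T ⨿ T)`: then `x`, `y` and
`x + y` are images of `w` under two morphisms and their sum. -/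
noncomputable def boxHom {S : FinGSet G} (m : M.obj ⟨S⟩) (T : FinGSet G) :
    BurnsideGroup (⟨T⟩ : BurnsideCat G) →+ (tildeBox N M).obj ⟨S ⨯ T⟩ :=
  AddMonoidHom.mk' (fun x => boxMk m (tildeMk N x)) fun x y => by
    let w : BurnsideGroup (⟨T ⨿ T⟩ : BurnsideCat G) :=
      BurnsideGroup.map (tr coprod.inl) x + BurnsideGroup.map (tr coprod.inr) y
    have hx : BurnsideGroup.map (res coprod.inl) w = x := by
      rw [map_add, ← AddMonoidHom.comp_apply, ← AddMonoidHom.comp_apply, ← BurnsideGroup.map_comp,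
        ← BurnsideGroup.map_comp, tr_inl_res_inl, tr_inr_res_inl, BurnsideGroup.map_id,
        BurnsideGroup.map_zero, AddMonoidHom.id_apply, AddMonoidHom.zero_apply, add_zero]
    have hy : BurnsideGroup.map (res coprod.inr) w = y := by
      rw [map_add, ← AddMonoidHom.comp_apply, ← AddMonoidHom.comp_apply, ← BurnsideGroup.map_comp,
        ← BurnsideGroup.map_comp, tr_inl_res_inr, tr_inr_res_inr, BurnsideGroup.map_id,
        BurnsideGroup.map_zero, AddMonoidHom.id_apply, AddMonoidHom.zero_apply, zero_add]
    have key (f : Burnside.mk (T ⨿ T) ⟶ Burnside.mk T) :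
        boxMk m (tildeMk N (BurnsideGroup.map f w)) = (tildeBox N M).map
          (prodHom (𝟙 _) f) (boxMk m (tildeMk N w)) := by
      rw [map_prodHom_boxMk, Functor.map_id_apply M, map_tildeMk]
    have hxy := key (res coprod.inl + res coprod.inr)
    rw [BurnsideGroup.map_add, AddMonoidHom.add_apply, hx, hy, prodHom_add, map_add_apply,
      ← key, ← key, hx, hy] at hxy
    exact hxy

variable [N.Normal]

/-- `M □ A / EF_N(A)` kills the classes of `M` at `G`-sets without `N`-fixed points. -/
theorem tildeUnit_eq_zero {V : FinGSet G} (hV : IsEmpty ((fixedPts N).obj V).V)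
    (m : M.obj ⟨V⟩) : (tildeUnit N M).app ⟨V⟩ m = 0 := by
  have h : tildeMk N (Algebra.GrothendieckAddGroup.of (res (terminal.from V))) =
      tildeMk N (T := ⟨V⟩) 0 :=
    tildeMk_eq_of_mem N (of_span_mem_subEF _ rfl hV _ _)
  rw [tildeUnit_app, tr_fst_eq, Functor.map_comp_apply, map_prodHom_boxMk, map_tildeOne, h,
    Functor.map_id_apply M]
  change (tildeBox N M).map _ (boxHom N m V 0) = 0
  rw [map_zero, map_apply_zero]

theorem map_span_tildeUnit_eq_zero {S T V : FinGSet G}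
    (hV : IsEmpty ((fixedPts N).obj V).V) (l : V ⟶ S) (r : V ⟶ T) (m : M.obj ⟨S⟩) :
    (tildeBox N M).map (Burnside.span l r) ((tildeUnit N M).app ⟨S⟩ m) = 0 := by
  rw [← res_comp_tr, Functor.map_comp_apply, ← NatTrans.naturality_apply,
    tildeUnit_eq_zero N hV, map_apply_zero]

/-- Any natural transformation from `M` to a Mackey functor that vanishes on `G`-sets without
`N`-fixed points extends to `M □ A / EF_N(A)`. -/
theorem exists_tildeDesc {M : SetFunctor G} {Y : SetFunctor G} [GroupValued Y]
    (hY : ∀ W : FinGSet G, IsEmpty ((fixedPts N).obj W).V → Subsingleton (Y.obj ⟨W⟩))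
    (φ : M ⟶ Y) : ∃ β : tildeBox N M ⟶ Y, tildeUnit N M ≫ β = φ := by
  -- on the class of a span `u : * → T` the map is forced to be `S × u`, applied to `φ(m)`
  let ψ (S T : FinGSet G) (m : M.obj ⟨S⟩) :
      BurnsideGroup (⟨T⟩ : BurnsideCat G) →+ Y.obj ⟨S ⨯ T⟩ :=
    Algebra.GrothendieckAddGroup.lift
      { toFun := fun u => Y.map (insertHom S u) (φ.app _ m)
        map_zero' := by
          rw [insertHom, prodHom_zero, Burnside.comp_zero, map_zero_apply]
        map_add' := fun u v => by rw [insertHom_add, map_add_apply] }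
  have hψof (S T : FinGSet G) (m : M.obj ⟨S⟩) (u) :
      ψ S T m (Algebra.GrothendieckAddGroup.of u) = Y.map (insertHom S u) (φ.app _ m) :=
    DFunLike.congr_fun (Algebra.GrothendieckAddGroup.lift.symm_apply_apply _) u
  have hψ (S S' T T' : FinGSet G) (f : Burnside.mk S ⟶ Burnside.mk S')
      (g : Burnside.mk T ⟶ Burnside.mk T') (m : M.obj ⟨S⟩) (x : BurnsideGroup ⟨T⟩) :
      ψ S' T' (M.map f m) (BurnsideGroup.map g x) = Y.map (prodHom f g) (ψ S T m x) := by
    let Yf : Y.obj ⟨S ⨯ T⟩ →+ Y.obj ⟨S' ⨯ T'⟩ :=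
      AddMonoidHom.mk' (Y.map (prodHom f g)) (map_apply_add _)
    refine DFunLike.congr_fun (f := (ψ S' T' (M.map f m)).comp (BurnsideGroup.map g))
      (g := Yf.comp (ψ S T m)) (BurnsideGroup.hom_ext fun u => ?_) x
    change ψ S' T' _ (BurnsideGroup.map g _) = Y.map _ (ψ S T m _)
    rw [BurnsideGroup.map_of, hψof, hψof, NatTrans.naturality_apply, ← Functor.map_comp_apply,
      ← Functor.map_comp_apply, insertHom_comp]
  -- generators of `EF_N(A)` factor through `Y(S × G/J)`, where `S × G/J` has no `N`-fixed points
  have hker (S T : FinGSet G) (m : M.obj ⟨S⟩) : subEF N ⟨T⟩ ≤ (ψ S T m).ker := by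
    refine (AddSubgroup.closure_le _).2 ?_
    rintro _ ⟨J, hJ, f, x, rfl⟩
    have := hY (S ⨯ orbit J) (isEmpty_fixedPts_of_hom prod.snd (isEmpty_fixedPts_orbit hJ))
    change ψ S T m _ = 0
    have h := hψ S S _ T (𝟙 _) f m x
    rw [Functor.map_id_apply M, Subsingleton.elim (ψ S (orbit J) m x) 0, map_apply_zero] at h
    exact h
  obtain ⟨β, hβ⟩ := exists_boxDesc (X := M) (Y := tildeEFA N) (Z := Y)
    (fun S T m => QuotientAddGroup.lift (subEF N ⟨T⟩) (ψ S T m) (hker S T m))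
    (fun S T S' T' f g m y => by
      obtain ⟨x, rfl⟩ := exists_tildeMk N y
      exact hψ S S' T T' f g m x)
  refine ⟨β, ?_⟩
  ext ⟨S⟩ m
  change β.app _ ((tildeBox N M).map _ (boxMk m (tildeOne N))) = φ.app _ m
  rw [NatTrans.naturality_apply, hβ]
  change Y.map _ (ψ S _ m (Algebra.GrothendieckAddGroup.of _)) = _
  rw [hψof, insertHom, prodHom_id, Category.comp_id, ← Functor.map_comp_apply,
    res_fst_comp_tr_fst, Functor.map_id_apply Y]

end TildeEF

end MackeyNorm

/-! ### Geometric fixed points as a left Kan extension -/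

namespace MackeyNorm

open Burnside

variable {G : Type u} [Group G] [Finite G] (N : Subgroup G) [N.Normal]

/-- The inclusion `S^N ⟶ S` of the fixed points. -/
noncomputable def fixedPtsι : fixedPts N ⋙ infl N ⟶ 𝟭 (FinGSet G) :=
  (inflFixedPtsAdjunction N).counit

instance (S : FinGSet G) : Mono ((fixedPtsι N).app S) := by
  refine ⟨fun f g h => Action.hom_ext _ _ (FintypeCat.hom_ext _ _ fun x => Subtype.ext ?_)⟩
  exact ConcreteCategory.congr_hom (congrArg Action.Hom.hom h) x

theorem map_res {C D : Type*} [Category* C] [Category* D] [HasPullbacks C] [HasPullbacks D]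
    (F : C ⥤ D) [PreservesLimitsOfShape WalkingCospan F] {X Y : C} (f : X ⟶ Y) :
    (Burnside.map F).map (res f) = res (F.map f) := by
  rw [res, Burnside.map_span, F.map_id]
  rfl

theorem map_tr {C D : Type*} [Category* C] [Category* D] [HasPullbacks C] [HasPullbacks D]
    (F : C ⥤ D) [PreservesLimitsOfShape WalkingCospan F] {X Y : C} (f : X ⟶ Y) :
    (Burnside.map F).map (tr f) = tr (F.map f) := by
  rw [tr, Burnside.map_span, F.map_id]
  rfl

/-- Fixed points, on Burnside categories. -/
noncomputable abbrev burnsideFix : BurnsideCat G ⥤ BurnsideCat (G ⧸ N) :=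
  Burnside.map (fixedPts N)

/-- Inflation, on Burnside categories. -/
noncomputable abbrev burnsideInfl : BurnsideCat (G ⧸ N) ⥤ BurnsideCat G :=
  Burnside.map (infl N)

/-- The restriction `S → S^N` to the fixed points, in the Burnside category. It is not natural: a
span `S ← U → T` may have points outside `U^N` over `T^N`. -/
noncomputable def resFixedPts (S : BurnsideCat G) :
    S ⟶ (burnsideInfl N).obj ((burnsideFix N).obj S) :=
  res ((fixedPtsι N).app S.as)

/-- The `N`-fixed points of an inflated set. -/
noncomputable def mapInflFixedPtsIso :
    burnsideInfl N ⋙ burnsideFix N ≅ 𝟭 (BurnsideCat (G ⧸ N)) :=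
  Burnside.mapCompIso _ _ ≪≫ Burnside.mapNatIso (inflFixedPtsIso N) ≪≫ Burnside.mapIdIso

theorem mapInflFixedPtsIso_hom_app (T : BurnsideCat (G ⧸ N)) :
    (mapInflFixedPtsIso N).hom.app T = tr ((inflFixedPtsIso N).hom.app T.as) :=
  (Category.id_comp _).trans (Category.comp_id _)

theorem map_resFixedPts_comp (S : BurnsideCat G) :
    (burnsideFix N).map (resFixedPts N S) ≫
      (mapInflFixedPtsIso N).hom.app ((burnsideFix N).obj S) = 𝟙 _ := by
  rw [mapInflFixedPtsIso_hom_app]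
  refine (congrArg (· ≫ _) (map_res (fixedPts N) ((fixedPtsι N).app S.as))).trans ?_
  refine (res_comp_tr _ _).trans ?_
  exact span_eq ((inflFixedPtsIso N).app _) rfl rfl

theorem resFixedPts_infl_comp (T : BurnsideCat (G ⧸ N)) :
    resFixedPts N ((burnsideInfl N).obj T) ≫
      (burnsideInfl N).map ((mapInflFixedPtsIso N).hom.app T) = 𝟙 _ := by
  rw [mapInflFixedPtsIso_hom_app]
  refine (congrArg (_ ≫ ·) (map_tr (infl N) ((inflFixedPtsIso N).hom.app T.as))).trans ?_
  refine (res_comp_tr _ _).trans ?_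
  exact span_eq ((infl N).mapIso ((inflFixedPtsIso N).app _)) rfl rfl

theorem isEmpty_fixedPts_compl {S V : FinGSet G} {j : V ⟶ S}
    (h : Nonempty (IsColimit (BinaryCofan.mk ((fixedPtsι N).app S) j))) :
    IsEmpty ((fixedPts N).obj V).V := by
  obtain ⟨-, -, h⟩ := (nonempty_isColimit_binaryCofan_iff _ _).1 h
  refine ⟨fun v => h.disjoint.le_bot ⟨⟨((fixedPts N).map j).hom v, rfl⟩, ⟨v.1, rfl⟩⟩⟩

section

variable {M : SetFunctor G} [GroupValued M]

/-- After composition with `M → ẼF_N(M)`, restriction to fixed points becomes natural for spans: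
a span decomposes into its part of `N`-fixed points and one that acts as zero. -/
theorem map_resFixedPts_tildeUnit {S T : BurnsideCat G} (f : S ⟶ T) (m : M.obj S) :
    (tildeBox N M).map (f ≫ resFixedPts N T) ((tildeUnit N M).app S m) =
      (tildeBox N M).map (resFixedPts N S ≫
        (burnsideInfl N).map ((burnsideFix N).map f))
          ((tildeUnit N M).app S m) := by
  obtain ⟨S⟩ := S
  obtain ⟨T⟩ := T
  induction f using hom_ind with
  | h V l r =>
    obtain ⟨V', j, hj⟩ := exists_compl ((fixedPtsι N).app V) (Subtype.val_injective)
    have hl : (fixedPtsι N).app V ≫ l = (infl N).map ((fixedPts N).map l) ≫ (fixedPtsι N).app S :=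
      ((fixedPtsι N).naturality l).symm
    have hr : (fixedPtsι N).app V ≫ r = (infl N).map ((fixedPts N).map r) ≫ (fixedPtsι N).app T :=
      ((fixedPtsι N).naturality r).symm
    have h : resFixedPts N ⟨S⟩ ≫
        (burnsideInfl N).map ((burnsideFix N).map (Burnside.span l r)) =
        Burnside.span ((fixedPtsι N).app V ≫ l) ((fixedPtsι N).app V ≫ r) ≫ resFixedPts N ⟨T⟩ := by
      have e : tr ((fixedPtsι N).app T) ≫ resFixedPts N ⟨T⟩ = 𝟙 _ := tr_comp_res_of_mono _
      rw [hl, hr, ← span_comp_tr]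
      refine (res_comp_span _ _ _).trans ?_
      refine Eq.trans ?_ (Category.assoc _ _ _).symm
      exact ((congrArg (_ ≫ ·) e).trans (Category.comp_id _)).symm
    rw [h, Functor.map_comp_apply, Functor.map_comp_apply, span_eq_add hj.some, map_add_apply,
      map_span_tildeUnit_eq_zero N (isEmpty_fixedPts_compl N hj), add_zero]

variable (M)

/-- The natural map `M(S) → ẼF_N(M)(S) → ẼF_N(M)(S^N) = (Φ^N M)(S^N)`. -/
noncomputable def toGeomFixedPts : M ⟶ burnsideFix N ⋙ (geomFixedPts N).obj M where
  app S := ↾(fun m => (tildeBox N M).map (resFixedPts N S) ((tildeUnit N M).app S m))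
  naturality S T f := by
    ext m
    change (tildeBox N M).map (resFixedPts N T) ((tildeUnit N M).app T (M.map f m)) =
      (tildeBox N M).map ((burnsideInfl N).map ((burnsideFix N).map f))
        ((tildeBox N M).map (resFixedPts N S) ((tildeUnit N M).app S m))
    rw [NatTrans.naturality_apply, ← Functor.map_comp_apply, ← Functor.map_comp_apply,
      map_resFixedPts_tildeUnit]

/-- The comparison map `Lan M → Φ^N M` from the left Kan extension along the fixed points
functor. -/
noncomputable def lanToGeomFixedPts :
    (burnsideFix N).lan.obj M ⟶ (geomFixedPts N).obj M :=
  Functor.descOfIsLeftKanExtension _ ((burnsideFix N).lanUnit.app M) _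
    (toGeomFixedPts N M)

variable {M}

theorem lanToGeomFixedPts_app_unit {S : BurnsideCat G} (m : M.obj S) :
    (lanToGeomFixedPts N M).app _ (((burnsideFix N).lanUnit.app M).app S m) =
      (tildeBox N M).map (resFixedPts N S) ((tildeUnit N M).app S m) :=
  ConcreteCategory.congr_hom (Functor.descOfIsLeftKanExtension_fac_app _
    ((burnsideFix N).lanUnit.app M) _ (toGeomFixedPts N M) S) m

theorem lanToGeomFixedPts_app_lanMk {S : BurnsideCat G} {T : BurnsideCat (G ⧸ N)}
    (f : (burnsideFix N).obj S ⟶ T) (m : M.obj S) :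
    (lanToGeomFixedPts N M).app T (lanMk (burnsideFix N) M f m) =
      (tildeBox N M).map (resFixedPts N S ≫ (burnsideInfl N).map f)
        ((tildeUnit N M).app S m) := by
  rw [lan_app_lanMk, lanToGeomFixedPts_app_unit, Functor.map_comp_apply]
  rfl

/-- The Kan extension `L` of `M` along fixed points, composed with fixed points, vanishes on
`G`-sets without fixed points. So the unit `M → L((-)^N)` extends to `ẼF_N(M)`, and the extension
inverts the comparison map on one side. -/
theorem lanToGeomFixedPts_injective (hL : GroupValued ((burnsideFix N).lan.obj M))
    (T : BurnsideCat (G ⧸ N)) :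
    Function.Injective ((lanToGeomFixedPts N M).app T) := by
  let L := (burnsideFix N).lan.obj M
  obtain ⟨β, hβ⟩ := exists_tildeDesc N (Y := burnsideFix N ⋙ L)
    (fun W hW => by
      refine ⟨fun x y => ?_⟩
      have e : 𝟙 (Burnside.mk ((fixedPts N).obj W)) = 0 :=
        span_eq_zero (isInitialOfIsEmpty _) _ _
      have h (x : L.obj ⟨(fixedPts N).obj W⟩) : x = 0 := by
        rw [← Functor.map_id_apply L _ x, e, map_zero_apply]
      exact (h x).trans (h y).symm)
    ((burnsideFix N).lanUnit.app M)
  have hβ' (S : BurnsideCat G) (m : M.obj S) : β.app S ((tildeUnit N M).app S m) =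
      ((burnsideFix N).lanUnit.app M).app S m :=
    ConcreteCategory.congr_hom (NatTrans.congr_app hβ S) m
  -- the extension `β`, on the inflated set `T` with `T^N ≅ T`, is a left inverse
  refine Function.LeftInverse.injective (g := fun z => L.map ((mapInflFixedPtsIso N).hom.app T)
    (β.app ((burnsideInfl N).obj T) z)) fun z => ?_
  obtain ⟨S, f, m, rfl⟩ := exists_lanMk _ z
  have h₁ : β.app ((burnsideInfl N).obj T)
      ((lanToGeomFixedPts N M).app T (lanMk (burnsideFix N) M f m)) =
        L.map ((burnsideFix N).map (resFixedPts N S ≫ (burnsideInfl N).map f))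
          (((burnsideFix N).lanUnit.app M).app S m) := by
    rw [lanToGeomFixedPts_app_lanMk]
    refine (NatTrans.naturality_apply β _ _).trans ?_
    rw [hβ']
    rfl
  have h₂ : (burnsideFix N).map (resFixedPts N S ≫ (burnsideInfl N).map f) ≫
      (mapInflFixedPtsIso N).hom.app T = f := by
    have := (mapInflFixedPtsIso N).hom.naturality f
    rw [Functor.map_comp, Category.assoc]
    refine (congrArg (_ ≫ ·) this).trans ?_
    rw [← Category.assoc, map_resFixedPts_comp]
    exact Category.id_comp _
  refine (congrArg _ h₁).trans ?_
  rw [← Functor.map_comp_apply, h₂]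
  rfl

/-- The image of the comparison map is a subgroup that contains the images of all elements of `M`
under spans, and these generate `ẼF_N(M)`. -/
theorem lanToGeomFixedPts_surjective (hL : GroupValued ((burnsideFix N).lan.obj M))
    (T : BurnsideCat (G ⧸ N)) :
    Function.Surjective ((lanToGeomFixedPts N M).app T) := by
  let L := (burnsideFix N).lan.obj M
  let α : L.obj T →+ ((geomFixedPts N).obj M).obj T :=
    AddMonoidHom.mk' ((lanToGeomFixedPts N M).app T) (app_add _)
  let IT := (burnsideInfl N).obj T
  -- the image contains everything that comes from `M`
  have key (S : BurnsideCat G) (g : S ⟶ IT) (m : M.obj S) :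
      (tildeBox N M).map g ((tildeUnit N M).app S m) ∈ α.range := by
    refine ⟨lanMk (burnsideFix N) M ((burnsideFix N).map g ≫ (mapInflFixedPtsIso N).hom.app T) m,
      (lanToGeomFixedPts_app_lanMk N _ m).trans ?_⟩
    change (tildeBox N M).map (_ ≫ (burnsideInfl N).map (_ ≫ _)) _ = (tildeBox N M).map g _
    rw [(burnsideInfl N).map_comp, ← Category.assoc, (tildeBox N M).map_comp_apply,
      ← map_resFixedPts_tildeUnit, ← (tildeBox N M).map_comp_apply, Category.assoc]
    refine congrArg (fun h => (tildeBox N M).map h ((tildeUnit N M).app S m)) ?_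
    exact (congrArg (g ≫ ·) (resFixedPts_infl_comp N T)).trans (Category.comp_id g)
  intro z
  obtain ⟨S, S', f, m, y, rfl⟩ := exists_boxMk (X := M) (Y := tildeEFA N) (T := IT) z
  obtain ⟨x, rfl⟩ := exists_tildeMk N y
  let θ : BurnsideGroup (⟨S'⟩ : BurnsideCat G) →+ ((geomFixedPts N).obj M).obj T :=
    AddMonoidHom.mk' (fun x => (tildeBox N M).map f (boxHom N m S' x)) fun x y => by
      rw [map_add, map_apply_add]
      exact (comp_obj_add (burnsideInfl N) (tildeBox N M) (T := T) _ _).symm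
  -- a homomorphism out of `A(S')` is determined by the classes of spans
  have hθ : (QuotientAddGroup.mk' α.range).comp θ = 0 := BurnsideGroup.hom_ext fun u =>
    (QuotientAddGroup.eq_zero_iff _).2 <| by
      change (tildeBox N M).map f (boxMk m (tildeMk N _)) ∈ α.range
      rw [boxMk_tildeMk_of, ← Functor.map_comp_apply]
      exact key _ _ _
  exact (QuotientAddGroup.eq_zero_iff (N := α.range) (θ x)).1 (DFunLike.congr_fun hθ x)

end

end MackeyNorm

/-! ### Fixed points of coinduced sets and the comparison -/

namespace MackeyNorm

open Burnside

variable {G : Type u} [Group G] [Finite G]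

theorem burnsideFix_map_zero (N : Subgroup G) [N.Normal] (S T : FinGSet G) :
    (burnsideFix N).map (0 : Burnside.mk S ⟶ Burnside.mk T) = 0 := by
  have : IsEmpty ((fixedPts N).obj (⊥_ FinGSet G)).V :=
    ⟨fun x => (isEmpty_of_isInitial (initialIsInitial (C := FinGSet G))).elim x.1⟩
  exact Burnside.span_eq_zero (isInitialOfIsEmpty _) _ _

instance lan_burnsideFix_groupValued (N : Subgroup G) [N.Normal] (X : SetFunctor G)
    [GroupValued X] : GroupValued ((burnsideFix N).lan.obj X) := by
  refine lan_groupValued _ (prodPres_of_preservesFiniteProducts X) fun S x => ?_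
  obtain ⟨z, hz, hz'⟩ := GroupValued.exists_neg S.as x
  refine ⟨_, z, res coprod.inl, tr (coprod.desc (𝟙 _) (𝟙 _)), 0,
    (burnsideFix N).map (res coprod.inr), hz, hz', ?_, burnsideFix_map_zero N _ _⟩
  rw [tr_codiag, Additive.map_add]

/-- On Mackey functors, geometric fixed points are the left Kan extension along the fixed points
functor. -/
noncomputable def lanIsoGeomFixedPts (N : Subgroup G) [N.Normal] :
    ObjectProperty.ι (IsMackey (G := G)) ⋙ (burnsideFix N).lan ≅
      ObjectProperty.ι (IsMackey (G := G)) ⋙ geomFixedPts N :=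
  NatIso.ofComponents
    (fun M =>
      have := M.property.groupValued
      have (T : BurnsideCat (G ⧸ N)) : IsIso ((lanToGeomFixedPts N M.obj).app T) :=
        (isIso_iff_bijective _).2 ⟨lanToGeomFixedPts_injective N inferInstance T,
          lanToGeomFixedPts_surjective N inferInstance T⟩
      have : IsIso (lanToGeomFixedPts N M.obj) := NatIso.isIso_of_isIso_app _
      asIso (lanToGeomFixedPts N M.obj))
    (fun {M M'} φ => by
      have := M.property.groupValued
      have := M'.property.groupValued
      refine Functor.hom_ext_of_isLeftKanExtension _ ((burnsideFix N).lanUnit.app M.obj) _ _ ?_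
      ext S m
      have h₁ := ConcreteCategory.congr_hom (NatTrans.congr_app
        ((burnsideFix N).lanUnit.naturality φ.hom) S) m
      change (lanToGeomFixedPts N M'.obj).app _ (((burnsideFix N).lan.map φ.hom).app _
        (((burnsideFix N).lanUnit.app M.obj).app S m)) =
        ((geomFixedPts N).map φ.hom).app _ ((lanToGeomFixedPts N M.obj).app _
          (((burnsideFix N).lanUnit.app M.obj).app S m))
      refine (congrArg _ h₁.symm).trans ?_
      refine (lanToGeomFixedPts_app_unit N (φ.hom.app S m)).trans ?_
      rw [lanToGeomFixedPts_app_unit]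
      change _ = ((box G).map (X := (M.obj, tildeEFA N)) (Y := (M'.obj, tildeEFA N))
        (φ.hom, 𝟙 _)).app _ ((tildeBox N M.obj).map _ _)
      rw [NatTrans.naturality_apply, tildeUnit_app (S := S.as), tildeUnit_app (S := S.as),
        NatTrans.naturality_apply, box_map_boxMk]
      rfl)

section Coinduction

variable (H N : Subgroup G) [N.Normal]

theorem quotientEquiv_symm_mk (h : H) (hh : QuotientGroup.mk' N h ∈ H.map (QuotientGroup.mk' N)) :
    (quotientEquiv H N).symm ⟨QuotientGroup.mk' N h, hh⟩ = QuotientGroup.mk h :=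
  (quotientEquiv H N).symm_apply_eq.2 rfl

/-- An `HN/N`-equivariant map `G/N → T^(H ∩ N)` gives an `N`-fixed `H`-equivariant map `G → T` by
composition with `G → G/N` and with the inclusion of the fixed points. -/
noncomputable def coindFixedPtsHom (T : FinGSet H) :
    (fixedPts (N.subgroupOf H) ⋙ Action.res FintypeCat.{u} (quotientEquiv H N).symm.toMonoidHom ⋙
      coind (H.map (QuotientGroup.mk' N))).obj T ⟶ (coind H ⋙ fixedPts N).obj T where
  hom := FintypeCat.homMk fun f => ⟨⟨fun g => (f.1 (QuotientGroup.mk' N g)).1, fun h g => by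
      have e := f.2 ⟨QuotientGroup.mk' N h, h, h.2, rfl⟩ (QuotientGroup.mk' N g)
      exact (congrArg Subtype.val e).trans (congrArg
        (fun q => (act ((fixedPts (N.subgroupOf H)).obj T) q (f.1 (QuotientGroup.mk' N g))).1)
        (quotientEquiv_symm_mk H N h _))⟩,
    fun n hn => Subtype.ext (funext fun g => by
      have e : QuotientGroup.mk' N (g * n) = QuotientGroup.mk' N g :=
        QuotientGroup.eq.2 (by simpa using hn)
      exact congrArg (fun q => (f.1 q).1) e)⟩
  comm g := by
    induction g using QuotientGroup.induction_on with
    | H g => rfl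

theorem coindFixedPtsHom_bijective (T : FinGSet H) :
    Function.Bijective (coindFixedPtsHom H N T).hom := by
  constructor
  · intro a b hab
    refine Subtype.ext (funext fun q => ?_)
    obtain ⟨g, rfl⟩ := QuotientGroup.mk'_surjective N q
    exact Subtype.ext (congrFun (congrArg (fun f => f.1.1) hab) g)
  · rintro ⟨⟨f, hf⟩, hN⟩
    have hfN (g : G) (n : G) (hn : n ∈ N) : f (g * n) = f g :=
      congrFun (congrArg Subtype.val (hN n hn)) g
    have hq (a b : G) (hab : QuotientGroup.mk' N a = QuotientGroup.mk' N b) : f a = f b := by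
      have := hfN a (a⁻¹ * b) (QuotientGroup.eq.1 hab)
      rw [← this, mul_inv_cancel_left]
    -- `f` takes values in the fixed points as `h g = g (g⁻¹ h g)` for `h ∈ H ∩ N`
    have hfix (g : G) (h : H) (hh : h ∈ N.subgroupOf H) : act T h (f g) = f g := by
      have := hfN g (g⁻¹ * h * g) (by
        simpa using Subgroup.Normal.conj_mem ‹_› (h : G) hh g⁻¹)
      rw [← hf h g]
      refine Eq.trans ?_ this
      congr 1
      group
    let F : G ⧸ N → ((fixedPts (N.subgroupOf H)).obj T).V :=
      fun q => ⟨f q.out, hfix _⟩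
    have hF (g : G) : (F (QuotientGroup.mk' N g)).1 = f g := hq _ _ (QuotientGroup.out_eq' _)
    refine ⟨⟨F, fun h q => ?_⟩, Subtype.ext (Subtype.ext (funext hF))⟩
    obtain ⟨_, h, hh, rfl⟩ := h
    obtain ⟨g, rfl⟩ := QuotientGroup.mk'_surjective N q
    refine Subtype.ext ?_
    refine (hF (h * g)).trans ((hf ⟨h, hh⟩ g).trans ?_)
    refine Eq.trans ?_ (congrArg
      (fun q => (act ((fixedPts (N.subgroupOf H)).obj T) q (F (QuotientGroup.mk' N g))).1)
      (quotientEquiv_symm_mk H N ⟨h, hh⟩ _)).symm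
    exact congrArg (act T ⟨h, hh⟩) (hF g).symm

theorem isIso_of_bijective {K : Type u} [Group K] {S T : FinGSet K} (f : S ⟶ T)
    (hf : Function.Bijective f.hom) : IsIso f := by
  have : IsIso ((Action.forget FintypeCat.{u} K ⋙ FintypeCat.incl).map f) :=
    (isIso_iff_bijective _).2 hf
  exact isIso_of_reflects_iso f (Action.forget FintypeCat.{u} K ⋙ FintypeCat.incl)

/-- Fixed points of a coinduced `G`-set: `F_H(G, T)^N ≅ F_{HN/N}(G/N, T^(H ∩ N))`. -/
noncomputable def coindFixedPtsIso :
    coind H ⋙ fixedPts N ≅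
      fixedPts (N.subgroupOf H) ⋙ Action.res FintypeCat.{u} (quotientEquiv H N).symm.toMonoidHom ⋙
        coind (H.map (QuotientGroup.mk' N)) :=
  (NatIso.ofComponents
    (fun T =>
      have := isIso_of_bijective _ (coindFixedPtsHom_bijective H N T)
      asIso (coindFixedPtsHom H N T))
    (fun _ => rfl)).symm

end Coinduction

section Transport

variable {Q Q' : Type u} [Group Q] [Group Q'] (e : Q ≃* Q')

/-- The equivalence of Burnside categories given by an isomorphism of groups. -/
noncomputable def burnsideEquiv : BurnsideCat Q ≌ BurnsideCat Q' :=
  CategoryTheory.Equivalence.mk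
    (Burnside.map (Action.res FintypeCat.{u} e.symm.toMonoidHom))
    (Burnside.map (Action.res FintypeCat.{u} e.toMonoidHom))
    (mapIdIso.symm ≪≫ mapNatIso (Action.resEquiv FintypeCat.{u} e.symm).unitIso ≪≫
      (mapCompIso _ _).symm)
    (mapCompIso _ _ ≪≫ mapNatIso (Action.resEquiv FintypeCat.{u} e.symm).counitIso ≪≫ mapIdIso)

/-- Transport along `e` is left adjoint to transport along its inverse. -/
noncomputable def transportAdjunction : transport e ⊣ (Functor.whiskeringLeft _ _ _).obj
    (Burnside.map (Action.res FintypeCat.{u} e.symm.toMonoidHom)) :=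
  ((burnsideEquiv e).congrLeft (E := Type (u + 1))).toAdjunction

instance (X : SetFunctor Q) [GroupValued X] : GroupValued ((transport e).obj X) :=
  inferInstanceAs (GroupValued (Burnside.map (Action.res FintypeCat.{u} e.toMonoidHom) ⋙ X))

end Transport

section Comparison

variable (H N : Subgroup G) [N.Normal]

/-- Both iterated Kan extensions are the Kan extension along `T ↦ F_H(G, T)^N`. They are left
adjoint to isomorphic restriction functors; in particular, transport along `H/(H ∩ N) ≅ HN/N` is
left adjoint to restriction along its inverse. -/
noncomputable def normLanIso :
    normFunctor H ⋙ (burnsideFix N).lan ≅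
      (burnsideFix (N.subgroupOf H)).lan ⋙ transport (quotientEquiv H N) ⋙
        normFunctor (H.map (QuotientGroup.mk' N)) :=
  let K : Burnside.map (coind H) ⋙ burnsideFix N ≅ burnsideFix (N.subgroupOf H) ⋙
      Burnside.map (Action.res FintypeCat.{u} (quotientEquiv H N).symm.toMonoidHom) ⋙
        Burnside.map (coind (H.map (QuotientGroup.mk' N))) :=
    mapCompIso _ _ ≪≫ mapNatIso (coindFixedPtsIso H N) ≪≫ (mapCompIso _ _).symm ≪≫
      Functor.isoWhiskerLeft _ (mapCompIso _ _).symm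
  (conjugateIsoEquiv
    (((burnsideFix (N.subgroupOf H)).lanAdjunction (Type (u + 1))).comp
      ((transportAdjunction (quotientEquiv H N)).comp
        ((Burnside.map (coind (H.map (QuotientGroup.mk' N)))).lanAdjunction (Type (u + 1)))))
    (((Burnside.map (coind H)).lanAdjunction (Type (u + 1))).comp
      ((burnsideFix N).lanAdjunction (Type (u + 1))))).symm
    (((Functor.whiskeringLeft _ _ (Type (u + 1))).mapIso K).symm)

/-- `Φ^N N_H^G ≅ N_{HN/N}^{G/N} Φ^{H ∩ N}` as functors from `H`-Mackey functors. -/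
noncomputable def geomFixedPtsNormIso :
    ObjectProperty.ι (IsMackey (G := H)) ⋙ normFunctor H ⋙ geomFixedPts N ≅
      ObjectProperty.ι (IsMackey (G := H)) ⋙ geomFixedPts (N.subgroupOf H) ⋙
        transport (quotientEquiv H N) ⋙ normFunctor (H.map (QuotientGroup.mk' N)) :=
  let J : Mack H ⥤ Mack G := ObjectProperty.lift IsMackey
    (ObjectProperty.ι (IsMackey (G := H)) ⋙ normFunctor H) fun M =>
      have := M.property.groupValued
      (isMackey_iff_groupValued _).2 (normFunctor_groupValued H M.obj)
  Functor.isoWhiskerLeft J (lanIsoGeomFixedPts N).symm ≪≫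
    Functor.isoWhiskerLeft (ObjectProperty.ι (IsMackey (G := H))) (normLanIso H N) ≪≫
    Functor.isoWhiskerRight (lanIsoGeomFixedPts (N.subgroupOf H))
      (transport (quotientEquiv H N) ⋙ normFunctor (H.map (QuotientGroup.mk' N)))

end Comparison

end MackeyNorm

open MackeyNorm in
theorem mainTheorem5 {G : Type u} [Group G] [Finite G] (H N : Subgroup G) [N.Normal] :
    ∃ (h₁ : ∀ M : Mack H, IsMackey ((geomFixedPts N).obj ((normFunctor H).obj M.obj)))
      (h₂ : ∀ M : Mack H, IsMackey ((normFunctor (H.map (QuotientGroup.mk' N))).obj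
        ((transport (quotientEquiv H N)).obj ((geomFixedPts (N.subgroupOf H)).obj M.obj)))),
      Nonempty
        (ObjectProperty.lift IsMackey
          (ObjectProperty.ι IsMackey ⋙ normFunctor H ⋙ geomFixedPts N) h₁ ≅
        ObjectProperty.lift IsMackey
          (ObjectProperty.ι IsMackey ⋙ geomFixedPts (N.subgroupOf H) ⋙
            transport (quotientEquiv H N) ⋙ normFunctor (H.map (QuotientGroup.mk' N))) h₂) := by
  refine ⟨fun M => ?_, fun M => ?_, ⟨?_⟩⟩
  · have := M.property.groupValued
    exact (isMackey_iff_groupValued _).2 inferInstance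
  · have := M.property.groupValued
    exact (isMackey_iff_groupValued _).2 inferInstance
  · exact NatIso.ofComponents
      (fun M => ObjectProperty.isoMk _ ((geomFixedPtsNormIso H N).app M))
      (fun f => by
        ext : 1
        exact (geomFixedPtsNormIso H N).hom.naturality f)
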